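/- Let $\delta\ge 1$ be an integer, $\tau=\tau_1+i\tau_2\in\mathbb C$ with $\tau_2>0$, $\Lambda=\mathbb Z\delta+\mathbb Z\tau$, and $M=\mathbb C/\Lambda$ with coordinate $z=z_1+iz_2$. Let $dx_1,dx_2$ be the real $1$-forms dual to the basis $\lambda_1=\delta,\lambda_2=\tau$ of $\Lambda$ and $\omega=\delta\,dx_1\wedge dx_2=\frac{i}{2\tau_2}dz\wedge d\bar z$. Let $L_0\to M$ be the holomorphic line bundle with multipliers $e_{\lambda_1}=1$, $e_{\lambda_2}(z)=e^{-2\pi i z-\pi i\tau}$ (so $c_1(L_0)=[\omega]$), with the metric $h_{L_0}(z)=e^{-\frac{2\pi}{\tau_2}z_2^2}$. Let $\hat M=\mathrm{Pic}^0(M)=\mathbb C/(\mathbb Z+\mathbb Z\frac{\tau}{\delta})$ with coordinate $\hat\mu=\hat\mu_1+i\hat\mu_2$, where $[\hat\mu]$ corresponds to the line bundle $P_{\hat\mu}$ on $M$ of the class $\hat\mu\,e_1^*\in H^{0,1}_{\bar\partial}(M)$, $e_1^*=-\frac{i}{2\tau_2}d\bar z$, i.e. with constant multipliers $e_\lambda=e^{2\pi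 i\hat\mu e_1^*(\lambda)}$; in these coordinates $\varphi_{L_0}:M\to\hat M$, $[\mu]\mapsto T_\mu^*L_0\otimes L_0^*$, is induced by the identity of $\mathbb C$. Let $\mathrm P\to M\times\hat M$ be the Poincaré line bundle: $\mathrm P|_{M\times\{\hat\mu\}}\cong P_{\hat\mu}$ for all $\hat\mu$, and $\mathrm P|_{\{0\}\times\hat M}$ is holomorphically trivial. Let $V=\mathbb C$, $V^*=\mathrm{Hom}_{\mathbb R}(V,\mathbb R)$, $\Lambda^*=\mathbb Z dx_1+\mathbb Z dx_2$, $M^*=V^*/2\pi\Lambda^*$, and let $\mathcal P\to M\times M^*$ be the gauge-theoretic Poincaré bundle: the quotient of the trivial line bundle on $M\times V^*$ by the action $2\pi\nu\circ(x,\xi,\sigma)=(x,\xi+2\pi\nu,e^{-2\pi i\langle\nu,x\rangle}\sigma)$ of $2\pi\Lambda^*$, with the connection $d+i\xi$ and the metric $h_{\mathcal P}$ induced by $\sigma_1\bar\sigma_2$. Let $Iso:\hat M\to M^*$ be $[\hat\mu]\mapsto[\xi_1dx_1+\xi_2dx_2]$, $\xi_1=\frac{2\pi\delta}{\tau_2}\hat\mu_2$,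 $\xi_2=\frac{2\pi}{\tau_2}(\tau_1\hat\mu_2-\tau_2\hat\mu_1)$. Give $(Id\times Iso)^*\mathcal P$ the pulled back metric and connection and the holomorphic structure defined by the $(0,1)$-part of that connection. There are a Poincaré bundle $\mathrm P$ and a holomorphic isomorphism $\Phi:\mathrm P\to(Id\times Iso)^*\mathcal P$. For every such $\mathrm P$ and $\Phi$, let $h_{\mathrm P}$ be the metric pulled back along $\Phi$, give $\tilde E=\pi_1^*L_0\otimes \mathrm P$ the metric $h_{\tilde E}=\pi_1^*h_{L_0}\otimes h_{\mathrm P}$, and put $L_{\hat\mu}=\tilde E|_{M\times\{\hat\mu\}}$. Then the direct image $E=(\pi_2)_*\tilde E$ is a holomorphic vector bundle of rank $\delta$ on $\hat M$ with fibres $H^0(M,L_{\hat\mu})$; the $L^2$-metric $h_E$ on it, $\langle f,g\rangle=\int_M h_{\tilde E}(z,\hat\mu)f(z)\overline{g(z)}\,\frac i2dz\wedge d\bar z$ on the fibre at $[\hat\mu]$, is a smooth Hermitian metric; and in every local holomorphic frame of $E$ the curvature of its Chern connection is $$\Theta(E,h_E)=-\frac{\pi}{\tau_2}\,d\hat\mu\wedge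 d\bar{\hat\mu}\cdot \mathrm{Id}_{\delta\times\delta}.$$ Consequently the first Chern form $c_1(E,h_E)=\frac{i}{2\pi}\operatorname{tr}\Theta(E,h_E)$ is, at the level of differential forms, $$c_1(E,h_E)=-\frac{i\delta}{2\tau_2}\,d\hat\mu\wedge d\bar{\hat\mu}=-\delta\,\omega,$$ where in the last expression $\omega$ is regarded as a form on $\hat M$ through the local coordinates $\hat\mu=z$, that is, $\varphi_{L_0}^*c_1(E,h_E)=-\delta\,\omega$ on $M$. -/

import Mathlib

open scoped ContDiff UpperHalfPlane ComplexConjugate ComplexOrder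

noncomputable section

namespace AdiabaticTorus

/-! # Line bundles on quotients by a lattice, given by multipliers -/

section LineBundles

/-- A holomorphic line bundle on the quotient `W / Γ` of a complex vector space by a group of
translations `ι : Γ → W`, given by a system of multipliers `e_γ(w)`.  Its sections are the
functions `s` on `W` with `s (w + γ) = e_γ(w) s(w)`. -/
structure HolLineBundle {W : Type*} [NormedAddCommGroup W] [NormedSpace ℂ W]
    {Γ : Type*} [AddCommGroup Γ] (ι : Γ →+ W) where
  mult : Γ → W → ℂ
  holo : ∀ γ, Differentiable ℂ (mult γ)
  ne_zero : ∀ γ w, mult γ w ≠ 0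
  cocycle : ∀ γ γ' w, mult (γ + γ') w = mult γ (w + ι γ') * mult γ' w

namespace HolLineBundle

variable {W : Type*} [NormedAddCommGroup W] [NormedSpace ℂ W]
  {Γ : Type*} [AddCommGroup Γ] {ι : Γ →+ W}
  {W' : Type*} [NormedAddCommGroup W'] [NormedSpace ℂ W']
  {Γ' : Type*} [AddCommGroup Γ'] {ι' : Γ' →+ W'}

/-- The trivial holomorphic line bundle. -/
def trivial (ι : Γ →+ W) : HolLineBundle ι where
  mult _ _ := 1
  holo _ := differentiable_const _
  ne_zero _ _ := one_ne_zero
  cocycle _ _ _ := (one_mul 1).symm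

/-- Tensor product of holomorphic line bundles. -/
def tensor (L L' : HolLineBundle ι) : HolLineBundle ι where
  mult γ w := L.mult γ w * L'.mult γ w
  holo γ := (L.holo γ).mul (L'.holo γ)
  ne_zero γ w := mul_ne_zero (L.ne_zero γ w) (L'.ne_zero γ w)
  cocycle γ γ' w := by rw [L.cocycle, L'.cocycle]; ring

/-- The dual line bundle. -/
def dual (L : HolLineBundle ι) : HolLineBundle ι where
  mult γ w := (L.mult γ w)⁻¹
  holo γ := (L.holo γ).inv (L.ne_zero γ)
  ne_zero γ w := inv_ne_zero (L.ne_zero γ w)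
  cocycle γ γ' w := by rw [L.cocycle, mul_inv]

/-- Pull-back along the map `W' / Γ' → W / Γ` induced by a holomorphic map `f : W' → W` that is
equivariant with respect to the homomorphism `k : Γ' → Γ`. -/
def pullback (L : HolLineBundle ι) (f : W' → W) (hf : Differentiable ℂ f) (k : Γ' →+ Γ)
    (hfk : ∀ γ w, f (w + ι' γ) = f w + ι (k γ)) : HolLineBundle ι' where
  mult γ w := L.mult (k γ) (f w)
  holo γ := (L.holo (k γ)).comp hf
  ne_zero γ w := L.ne_zero _ _
  cocycle γ γ' w := by rw [map_add, L.cocycle, hfk]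

/-- Existence of a holomorphic isomorphism of line bundles. -/
def IsIso (L L' : HolLineBundle ι) : Prop :=
  ∃ g : W → ℂ, Differentiable ℂ g ∧ (∀ w, g w ≠ 0) ∧
    ∀ γ w, g (w + ι γ) * L.mult γ w = L'.mult γ w * g w

/-- `s` is a holomorphic section of `L` over the image in `W / Γ` of the `Γ`-invariant open set
`O ⊆ W`; the values of `s` outside `O` are irrelevant. -/
def IsSectionOn (L : HolLineBundle ι) (O : Set W) (s : W → ℂ) : Prop :=
  DifferentiableOn ℂ s O ∧ ∀ γ, ∀ w ∈ O, s (w + ι γ) = L.mult γ w * s w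

/-- The space `H⁰(W / Γ, L)` of global holomorphic sections. -/
def H0 (L : HolLineBundle ι) : Submodule ℂ (W → ℂ) where
  carrier := {s | Differentiable ℂ s ∧ ∀ γ w, s (w + ι γ) = L.mult γ w * s w}
  add_mem' := by
    rintro s t ⟨hs, hs'⟩ ⟨ht, ht'⟩
    refine ⟨hs.add ht, fun γ w => ?_⟩
    simp only [Pi.add_apply, hs', ht']; ring
  zero_mem' := ⟨differentiable_const _, fun γ w => by simp⟩
  smul_mem' := by
    rintro c s ⟨hs, hs'⟩
    refine ⟨hs.const_smul c, fun γ w => ?_⟩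
    simp only [Pi.smul_apply, hs', smul_eq_mul]; ring

end HolLineBundle

/-- A smooth Hermitian line bundle with unitary connection on `W / Γ`: multipliers, the connection
`∇ = d + A` (`conn` is `A`) and the metric `|s|² = metric · s s̄`. -/
structure GaugeLineBundle {W : Type*} [NormedAddCommGroup W] [NormedSpace ℝ W]
    {Γ : Type*} [AddCommGroup Γ] (ι : Γ →+ W) where
  mult : Γ → W → ℂ
  smooth : ∀ γ, ContDiff ℝ ∞ (mult γ)
  ne_zero : ∀ γ w, mult γ w ≠ 0
  cocycle : ∀ γ γ' w, mult (γ + γ') w = mult γ (w + ι γ') * mult γ' w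
  conn : W → W →L[ℝ] ℂ
  conn_smooth : ContDiff ℝ ∞ conn
  conn_mult : ∀ γ w v,
    fderiv ℝ (mult γ) w v + conn (w + ι γ) v * mult γ w = mult γ w * conn w v
  metric : W → ℝ
  metric_smooth : ContDiff ℝ ∞ metric
  metric_pos : ∀ w, 0 < metric w
  metric_mult : ∀ γ w, metric (w + ι γ) * ‖mult γ w‖ ^ 2 = metric w
  unitary : ∀ w v, fderiv ℝ metric w v = 2 * metric w * (conn w v).re

namespace GaugeLineBundle

/-- Pull-back along the map of quotients induced by an equivariant real linear map. -/
def pullback {W : Type*} [NormedAddCommGroup W] [NormedSpace ℝ W]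
    {Γ : Type*} [AddCommGroup Γ] {ι : Γ →+ W}
    {W' : Type*} [NormedAddCommGroup W'] [NormedSpace ℝ W']
    {Γ' : Type*} [AddCommGroup Γ'] {ι' : Γ' →+ W'}
    (G : GaugeLineBundle ι) (f : W' →L[ℝ] W) (k : Γ' →+ Γ) (hfk : ∀ γ, f (ι' γ) = ι (k γ)) :
    GaugeLineBundle ι' where
  mult γ w := G.mult (k γ) (f w)
  smooth γ := (G.smooth (k γ)).comp f.contDiff
  ne_zero γ w := G.ne_zero _ _
  cocycle γ γ' w := by rw [map_add, G.cocycle, map_add, hfk]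
  conn w := (G.conn (f w)).comp f
  conn_smooth := (G.conn_smooth.comp f.contDiff).clm_comp contDiff_const
  conn_mult γ w v := by
    have h : HasFDerivAt (fun w => G.mult (k γ) (f w))
        ((fderiv ℝ (G.mult (k γ)) (f w)).comp f) w :=
      (((G.smooth (k γ)).differentiable (by simp)) (f w)).hasFDerivAt.comp w f.hasFDerivAt
    rw [h.fderiv, map_add, hfk]
    exact G.conn_mult (k γ) (f w) (f v)
  metric w := G.metric (f w)
  metric_smooth := G.metric_smooth.comp f.contDiff
  metric_pos w := G.metric_pos _
  metric_mult γ w := by rw [map_add, hfk, G.metric_mult]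
  unitary w v := by
    have h : HasFDerivAt (fun w => G.metric (f w)) ((fderiv ℝ G.metric (f w)).comp f) w :=
      ((G.metric_smooth.differentiable (by simp)) (f w)).hasFDerivAt.comp w f.hasFDerivAt
    rw [h.fderiv]
    exact G.unitary (f w) (f v)

variable {W : Type*} [NormedAddCommGroup W] [NormedSpace ℂ W]
  {Γ : Type*} [AddCommGroup Γ] {ι : Γ →+ W}

/-- The covariant derivative `∇_v s = ds(v) + A(v) s`. -/
def nabla (G : GaugeLineBundle ι) (s : W → ℂ) (w v : W) : ℂ :=
  fderiv ℝ s w v + G.conn w v * s w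

/-- `Φ` is an isomorphism (`s ↦ Φ s`) from the holomorphic line bundle `P` to `G`, holomorphic
for the holomorphic structure on `G` defined by the connection: `Φ` is annihilated by the
`(0,1)`-part `½ (∇_v + i ∇_{iv})` of `∇`. -/
structure IsIdentification (P : HolLineBundle ι) (G : GaugeLineBundle ι) (Φ : W → ℂ) :
    Prop where
  smooth : ContDiff ℝ ∞ Φ
  ne_zero : ∀ w, Φ w ≠ 0
  equivariant : ∀ γ w, Φ (w + ι γ) * P.mult γ w = G.mult γ w * Φ w
  dbar : ∀ w v, G.nabla Φ w v + Complex.I * G.nabla Φ w (Complex.I • v) = 0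

/-- The metric of `G` pulled back along the isomorphism `s ↦ Φ s`. -/
def pullbackMetric (G : GaugeLineBundle ι) (Φ : W → ℂ) (w : W) : ℝ :=
  G.metric w * ‖Φ w‖ ^ 2

end GaugeLineBundle

end LineBundles

/-! # The Chern curvature of a Hermitian holomorphic vector bundle over a domain of `ℂ` -/

section Chern

/-- The `(1,0)`-part `∂f` of `df`, evaluated on the tangent vector `v`. -/
def del (f : ℂ → ℂ) (x v : ℂ) : ℂ :=
  (1 / 2) * (fderiv ℝ f x v - Complex.I * fderiv ℝ f x (Complex.I * v))

variable {n : Type*} [Fintype n] [DecidableEq n]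

/-- The matrix of the Chern connection in a holomorphic frame `s` with Gram matrix
`H i j = ⟨s i, s j⟩`: `∇ s i = ∑ j, θ i j s j` with `θ = ∂H · H⁻¹`. -/
def chernForm (H : ℂ → Matrix n n ℂ) (x v : ℂ) : Matrix n n ℂ :=
  Matrix.of (fun i j => del (fun y => H y i j) x v) * (H x)⁻¹

/-- The curvature matrix `Θ = dθ - θ ∧ θ` of the Chern connection in a holomorphic frame with
Gram matrix `H`, as a 2-form at `x` evaluated on tangent vectors `u, v`. -/
def chernCurvature (H : ℂ → Matrix n n ℂ) (x u v : ℂ) : Matrix n n ℂ :=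
  Matrix.of (fun i j => fderiv ℝ (fun y => chernForm H y v i j) x u
      - fderiv ℝ (fun y => chernForm H y u i j) x v)
    - (chernForm H x u * chernForm H x v - chernForm H x v * chernForm H x u)

/-- The first Chern form `c₁ = (i / 2π) tr Θ`. -/
def chernOne (H : ℂ → Matrix n n ℂ) (x u v : ℂ) : ℂ :=
  (Complex.I / (2 * Real.pi)) * (chernCurvature H x u v).trace

/-- The 2-form `dw ∧ dw̄` on `ℂ`. -/
def dwdwbar (u v : ℂ) : ℂ := u * conj v - v * conj u

end Chern

/-! # The torus `M`, its dual `M̂`, and the line bundle `L₀` -/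

section Torus

/-- The periods `λ₁ = δ`, `λ₂ = τ` of `M` in the coordinate `z`. -/
def period (δ : ℕ) (τ : ℍ) : ℤ × ℤ →+ ℂ where
  toFun a := a.1 * δ + a.2 * (τ : ℂ)
  map_zero' := by simp
  map_add' a b := by simp only [Prod.fst_add, Prod.snd_add, Int.cast_add]; ring

/-- The periods `1`, `τ / δ` of `M̂` in the coordinate `μ̂`. -/
def dualPeriod (δ : ℕ) (τ : ℍ) : ℤ × ℤ →+ ℂ where
  toFun m := m.1 + m.2 * ((τ : ℂ) / δ)
  map_zero' := by simp
  map_add' a b := by simp only [Prod.fst_add, Prod.snd_add, Int.cast_add]; ring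

/-- The periods of `M × M̂` in the coordinates `(z, μ̂)`. -/
def prodPeriod (δ : ℕ) (τ : ℍ) : (ℤ × ℤ) × (ℤ × ℤ) →+ ℂ × ℂ :=
  (period δ τ).prodMap (dualPeriod δ τ)

/-- The complex torus `M = V / Λ`, `V = ℂ`. -/
abbrev M (δ : ℕ) (τ : ℍ) : Type := ℂ ⧸ (period δ τ).range

/-- The dual torus `M̂ = Pic⁰(M)`: the space `V̄* = H^{0,1}(M)` of conjugate linear functionals
`μ̂ e₁*`, with `e₁*` as in `e1Star`, modulo the lattice of the `(0,1)`-parts of the integral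
constant 1-forms.  The line bundle that corresponds to `[μ̂]` is `picBundle δ τ μ̂`. -/
abbrev MHat (δ : ℕ) (τ : ℍ) : Type := ℂ ⧸ (dualPeriod δ τ).range

/-- The real 1-form `dx₁` on `V` of the basis dual to `λ₁, λ₂`. -/
def dx1 (δ : ℕ) (τ : ℍ) : ℂ →L[ℝ] ℝ :=
  (1 / (δ : ℝ)) • (Complex.reCLM - (τ.re / τ.im) • Complex.imCLM)

/-- The real 1-form `dx₂` on `V` of the basis dual to `λ₁, λ₂`. -/
def dx2 (τ : ℍ) : ℂ →L[ℝ] ℝ := (1 / τ.im) • Complex.imCLM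

/-- The 2-form `ω = δ dx₁ ∧ dx₂` on `V`; it is also regarded as a 2-form on `V̄*`, by means of the
lift of `φ_{L₀} : M → M̂`, which is the identity in the coordinates `z` and `μ̂`. -/
def omega (δ : ℕ) (τ : ℍ) (u v : ℂ) : ℝ :=
  δ * (dx1 δ τ u * dx2 τ v - dx1 δ τ v * dx2 τ u)

/-- The conjugate linear functional `e₁* = -dx₂* = -(i / 2τ₂) dz̄`. -/
def e1Star (τ : ℍ) (v : ℂ) : ℂ := -(Complex.I / (2 * τ.im)) * conj v

/-- The line bundle `P_μ̂` in `Pic⁰(M)` of the class `α = μ̂ e₁*` in `H^{0,1}(M)`, with the constant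
multipliers `exp (2πi α(λ))`. -/
def picBundle (δ : ℕ) (τ : ℍ) (μ : ℂ) : HolLineBundle (period δ τ) where
  mult a _ := Complex.exp (2 * Real.pi * Complex.I * (μ * e1Star τ (period δ τ a)))
  holo _ := differentiable_const _
  ne_zero _ _ := Complex.exp_ne_zero _
  cocycle a b _ := by
    rw [← Complex.exp_add]; congr 1
    simp only [map_add, e1Star]; ring

/-- The line bundle `L₀` of degree `δ` on `M`, with multipliers `e_{λ₁} = 1` and
`e_{λ₂}(z) = exp (-2πi z - πi τ)`. -/
def L0 (δ : ℕ) (τ : ℍ) : HolLineBundle (period δ τ) where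
  mult a z := Complex.exp (-2 * Real.pi * Complex.I * a.2 * z
    - Real.pi * Complex.I * a.2 ^ 2 * (τ : ℂ))
  holo a := by fun_prop
  ne_zero _ _ := Complex.exp_ne_zero _
  cocycle a b z := by
    rw [← Complex.exp_add, Complex.exp_eq_exp_iff_exists_int]
    refine ⟨a.2 * b.1 * δ, ?_⟩
    simp only [period, AddMonoidHom.coe_mk, ZeroHom.coe_mk, Prod.snd_add]
    push_cast; ring

/-- The metric `h_{L₀}(z) = exp (-(2π / τ₂) z₂²)` on `L₀`. -/
def hL0 (τ : ℍ) (z : ℂ) : ℝ := Real.exp (-(2 * Real.pi / τ.im) * z.im ^ 2)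

/-- The pull-back `T_μ^* L` under the translation by `μ`. -/
def translate (δ : ℕ) (τ : ℍ) (L : HolLineBundle (period δ τ)) (μ : ℂ) :
    HolLineBundle (period δ τ) :=
  L.pullback (fun z => z + μ) (by fun_prop) (AddMonoidHom.id _)
    (fun γ w => by simp only [AddMonoidHom.id_apply]; ring)

/-- The map `φ_{L₀} : M → M̂`, `[μ] ↦ T_μ^* L₀ ⊗ L₀^*`, is the identity in the coordinates
`μ` and `μ̂`. -/
theorem picBundle_isIso_translate (δ : ℕ) (τ : ℍ) (μ : ℂ) :
    (picBundle δ τ μ).IsIso ((translate δ τ (L0 δ τ) μ).tensor (L0 δ τ).dual) := by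
  have hτ : (τ.im : ℂ) ≠ 0 := by exact_mod_cast τ.im_pos.ne'
  refine ⟨fun z => Complex.exp (-(Real.pi * μ / τ.im) * z), by fun_prop,
    fun _ => Complex.exp_ne_zero _, fun a z => ?_⟩
  have hc : conj (τ : ℂ) = (τ : ℂ) - 2 * τ.im * Complex.I := by
    apply Complex.ext <;> simp; ring
  simp only [picBundle, HolLineBundle.tensor, HolLineBundle.dual, translate,
    HolLineBundle.pullback, L0, e1Star, AddMonoidHom.id_apply, period, AddMonoidHom.coe_mk,
    ZeroHom.coe_mk, ← Complex.exp_neg, ← Complex.exp_add, map_add, map_mul, Complex.conj_natCast,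
    map_intCast, hc]
  congr 1
  field_simp
  ring_nf
  simp only [Complex.I_sq, Complex.I_pow_three]
  ring

end Torus

/-! # The gauge-theoretic Poincaré bundle -/

section Gauge

/-- The periods `2π Λ*` of `M* = V* / 2π Λ*`, where `Λ* = ℤ dx₁ + ℤ dx₂`. -/
def starPeriod (δ : ℕ) (τ : ℍ) : ℤ × ℤ →+ (ℂ →L[ℝ] ℝ) where
  toFun k := (2 * Real.pi) • ((k.1 : ℝ) • dx1 δ τ + (k.2 : ℝ) • dx2 τ)
  map_zero' := by simp
  map_add' a b := by
    simp only [Prod.fst_add, Prod.snd_add, Int.cast_add, add_smul, smul_add]; abel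

theorem dx1_period (δ : ℕ) [NeZero δ] (τ : ℍ) (a : ℤ × ℤ) : dx1 δ τ (period δ τ a) = a.1 := by
  have hδ : (δ : ℝ) ≠ 0 := NeZero.ne _
  have hτ : τ.im ≠ 0 := τ.im_pos.ne'
  simp [dx1, period]
  field_simp
  ring

theorem dx2_period (δ : ℕ) (τ : ℍ) (a : ℤ × ℤ) : dx2 τ (period δ τ a) = a.2 := by
  have hτ : τ.im ≠ 0 := τ.im_pos.ne'
  simp [dx2, period]
  field_simp

/-- The line bundle `𝒫` on `M × M*`: the quotient of the trivial bundle on `M × V*` by the action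
`2πν · (x, ξ, σ) = (x, ξ + 2πν, exp (-2πi ⟨ν, x⟩) σ)` of `2π Λ*`, with the connection `d + i ξ` and
the metric `σ₁ σ̄₂`. -/
def gaugePoincare (δ : ℕ) [NeZero δ] (τ : ℍ) :
    GaugeLineBundle ((period δ τ).prodMap (starPeriod δ τ)) where
  mult γ w := Complex.exp (-2 * Real.pi * Complex.I *
    ((γ.2.1 * dx1 δ τ w.1 + γ.2.2 * dx2 τ w.1 : ℝ) : ℂ))
  smooth γ := by
    have h : ContDiff ℝ ∞ fun w : ℂ × (ℂ →L[ℝ] ℝ) =>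
        ((γ.2.1 * dx1 δ τ w.1 + γ.2.2 * dx2 τ w.1 : ℝ) : ℂ) :=
      (Complex.ofRealCLM.comp (((γ.2.1 : ℝ) • dx1 δ τ + (γ.2.2 : ℝ) • dx2 τ).comp
        (ContinuousLinearMap.fst ℝ ℂ (ℂ →L[ℝ] ℝ)))).contDiff
    exact (contDiff_const.mul h).cexp
  ne_zero _ _ := Complex.exp_ne_zero _
  cocycle γ γ' w := by
    rw [← Complex.exp_add, Complex.exp_eq_exp_iff_exists_int]
    refine ⟨γ.2.1 * γ'.1.1 + γ.2.2 * γ'.1.2, ?_⟩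
    simp only [AddMonoidHom.prodMap_def, AddMonoidHom.prod_apply, AddMonoidHom.comp_apply,
      AddMonoidHom.coe_fst, AddMonoidHom.coe_snd, Prod.fst_add, Prod.snd_add, map_add,
      dx1_period, dx2_period]
    push_cast; ring
  conn w := Complex.I • Complex.ofRealCLM.comp (w.2.comp (ContinuousLinearMap.fst ℝ _ _))
  conn_smooth := by fun_prop
  conn_mult γ w v := by
    have h : HasFDerivAt (fun w : ℂ × (ℂ →L[ℝ] ℝ) =>
        ((γ.2.1 * dx1 δ τ w.1 + γ.2.2 * dx2 τ w.1 : ℝ) : ℂ))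
        (Complex.ofRealCLM.comp (((γ.2.1 : ℝ) • dx1 δ τ + (γ.2.2 : ℝ) • dx2 τ).comp
          (ContinuousLinearMap.fst ℝ ℂ (ℂ →L[ℝ] ℝ)))) w :=
      (Complex.ofRealCLM.comp (((γ.2.1 : ℝ) • dx1 δ τ + (γ.2.2 : ℝ) • dx2 τ).comp
          (ContinuousLinearMap.fst ℝ ℂ (ℂ →L[ℝ] ℝ)))).hasFDerivAt
    rw [((h.const_mul (-2 * Real.pi * Complex.I)).cexp).fderiv]
    simp [AddMonoidHom.prodMap_def, starPeriod]
    ring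
  metric _ := 1
  metric_smooth := contDiff_const
  metric_pos _ := one_pos
  metric_mult γ w := by
    rw [Complex.norm_exp]
    simp
  unitary w v := by simp

/-- The lift `V̄* → V*` of the isomorphism `Iso : M̂ → M*`, `dxᵢ* ↦ 2π dxᵢ`: it maps `μ̂` to
`ξ₁ dx₁ + ξ₂ dx₂`, `ξ₁ = (2πδ / τ₂) μ̂₂`, `ξ₂ = (2π / τ₂) (τ₁ μ̂₂ - τ₂ μ̂₁)`. -/
def isoLift (δ : ℕ) (τ : ℍ) : ℂ →L[ℝ] (ℂ →L[ℝ] ℝ) :=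
  ((2 * Real.pi * δ / τ.im) • Complex.imCLM).smulRight (dx1 δ τ) +
  ((2 * Real.pi / τ.im) • (τ.re • Complex.imCLM - τ.im • Complex.reCLM)).smulRight (dx2 τ)

/-- The map `(m₁, m₂) ↦ (m₂, -m₁)` that `Iso` induces on the lattices. -/
def isoLattice : ℤ × ℤ →+ ℤ × ℤ where
  toFun m := (m.2, -m.1)
  map_zero' := by simp
  map_add' a b := by ext <;> simp; ring

theorem isoLift_dualPeriod (δ : ℕ) [NeZero δ] (τ : ℍ) (m : ℤ × ℤ) :
    isoLift δ τ (dualPeriod δ τ m) = starPeriod δ τ (isoLattice m) := by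
  have hδ : (δ : ℝ) ≠ 0 := NeZero.ne _
  have hτ : τ.im ≠ 0 := τ.im_pos.ne'
  have h1 : (dualPeriod δ τ m).re = m.1 + m.2 * (τ.re / δ) := by
    simp [dualPeriod]
  have h2 : (dualPeriod δ τ m).im = m.2 * (τ.im / δ) := by
    simp [dualPeriod]
  ext
  all_goals
    simp [isoLift, starPeriod, isoLattice, h1, h2]
    field_simp
    ring

/-- The bundle `(Id × Iso)^* 𝒫` on `M × M̂`, with the pulled back connection and metric. -/
def gaugePullback (δ : ℕ) [NeZero δ] (τ : ℍ) : GaugeLineBundle (prodPeriod δ τ) :=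
  (gaugePoincare δ τ).pullback
    ((ContinuousLinearMap.id ℝ ℂ).prodMap (isoLift δ τ))
    ((AddMonoidHom.id _).prodMap isoLattice)
    (fun γ => by
      simp [prodPeriod, AddMonoidHom.prodMap_def, isoLift_dualPeriod])

end Gauge

/-! # The Poincaré bundle, the direct image `E`, and its `L²`-metric -/

section DirectImage

/-- The restriction of a line bundle on `M × M̂` to `M × {μ̂}`. -/
def restrictM {δ : ℕ} {τ : ℍ} (L : HolLineBundle (prodPeriod δ τ)) (μ : ℂ) :
    HolLineBundle (period δ τ) :=
  L.pullback (fun z => (z, μ)) (by fun_prop) (AddMonoidHom.inl _ _)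
    (fun γ w => by simp [prodPeriod, AddMonoidHom.prodMap_def])

/-- The restriction of a line bundle on `M × M̂` to `{0} × M̂`. -/
def restrictMHat {δ : ℕ} {τ : ℍ} (L : HolLineBundle (prodPeriod δ τ)) :
    HolLineBundle (dualPeriod δ τ) :=
  L.pullback (fun μ => (0, μ)) (by fun_prop) (AddMonoidHom.inr _ _)
    (fun γ w => by simp [prodPeriod, AddMonoidHom.prodMap_def])

/-- `P` is a Poincaré line bundle on `M × M̂`. -/
structure IsPoincare {δ : ℕ} {τ : ℍ} (P : HolLineBundle (prodPeriod δ τ)) : Prop where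
  restrict : ∀ μ, (restrictM P μ).IsIso (picBundle δ τ μ)
  normalized : (restrictMHat P).IsIso (HolLineBundle.trivial _)

/-- The line bundle `Ẽ = π₁^* L₀ ⊗ P` on `M × M̂`. -/
def ETilde {δ : ℕ} {τ : ℍ} (P : HolLineBundle (prodPeriod δ τ)) :
    HolLineBundle (prodPeriod δ τ) :=
  HolLineBundle.tensor
    ((L0 δ τ).pullback Prod.fst differentiable_fst (AddMonoidHom.fst _ _)
      (fun γ w => by simp [prodPeriod, AddMonoidHom.prodMap_def])) P

/-- The metric `h_Ẽ = π₁^* h_{L₀} ⊗ h_P` on `Ẽ`, where `h_P` is pulled back from the metric of the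
gauge-theoretic Poincaré bundle along the isomorphism `Φ`. -/
def hETilde (δ : ℕ) [NeZero δ] (τ : ℍ) (Φ : ℂ × ℂ → ℂ) (w : ℂ × ℂ) : ℝ :=
  hL0 τ w.1 * (gaugePullback δ τ).pullbackMetric Φ w

/-- The fibre `H⁰(M, L_μ̂)` of `E` at `[μ̂]`, where `L_μ̂` is the restriction of `Ẽ` to `M × {μ̂}`.
The fibres at two lifts of the same point of `M̂` are identified by the multipliers of `Ẽ`. -/
def EFibre {δ : ℕ} {τ : ℍ} (P : HolLineBundle (prodPeriod δ τ)) (μ : ℂ) : Submodule ℂ (ℂ → ℂ) :=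
  (restrictM (ETilde P) μ).H0

/-- The preimage in the coordinate plane of `μ̂` of a subset of `M̂`. -/
def lift {δ : ℕ} {τ : ℍ} (U : Set (MHat δ τ)) : Set ℂ := {μ | (μ : MHat δ τ) ∈ U}

/-- `s` is a holomorphic section over `U` of the direct image `E = π₂_* Ẽ`, that is, a holomorphic
section of `Ẽ` over `M × U`. -/
def IsESection {δ : ℕ} {τ : ℍ} (P : HolLineBundle (prodPeriod δ τ)) (U : Set (MHat δ τ))
    (s : ℂ × ℂ → ℂ) : Prop :=
  (ETilde P).IsSectionOn (Set.univ ×ˢ lift U) s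

/-- `s` is a holomorphic frame of `E` over `U`: holomorphic sections that form a basis of the fibre
`H⁰(M, L_μ̂)` at each point of `U`. -/
structure IsEFrame {δ : ℕ} {τ : ℍ} (P : HolLineBundle (prodPeriod δ τ)) (U : Set (MHat δ τ))
    {n : ℕ} (s : Fin n → ℂ × ℂ → ℂ) : Prop where
  isSection : ∀ i, IsESection P U (s i)
  linearIndependent : ∀ μ ∈ lift U, LinearIndependent ℂ (fun i z => s i (z, μ))
  span_eq : ∀ μ ∈ lift U, Submodule.span ℂ (Set.range (fun i z => s i (z, μ))) = EFibre P μ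

/-- `E` is a holomorphic vector bundle of rank `n` on `M̂` with fibres `H⁰(M, L_μ̂)`: it has
holomorphic frames with `n` members near every point, and holomorphic sections have holomorphic
coefficients in each frame. -/
structure IsHolVectorBundle {δ : ℕ} {τ : ℍ} (P : HolLineBundle (prodPeriod δ τ)) (n : ℕ) :
    Prop where
  exists_frame : ∀ x : MHat δ τ, ∃ U : Set (MHat δ τ), IsOpen U ∧ x ∈ U ∧
    ∃ s : Fin n → ℂ × ℂ → ℂ, IsEFrame P U s
  coeff : ∀ U : Set (MHat δ τ), IsOpen U → ∀ s : Fin n → ℂ × ℂ → ℂ, IsEFrame P U s →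
    ∀ t, IsESection P U t → ∃ c : Fin n → ℂ → ℂ, (∀ i, DifferentiableOn ℂ (c i) (lift U)) ∧
      ∀ μ ∈ lift U, ∀ z, t (z, μ) = ∑ i, c i μ * s i (z, μ)

/-- The fundamental parallelogram of `M`. -/
def parallelogram (δ : ℕ) (τ : ℍ) : Set ℂ :=
  {z | ∃ a ∈ Set.Ico (0 : ℝ) 1, ∃ b ∈ Set.Ico (0 : ℝ) 1, z = a * δ + b * (τ : ℂ)}

/-- The `L²`-metric `h_E` on the fibre of `E` at `[μ̂]`:
`⟨f, g⟩ = ∫_M h_Ẽ(z, μ̂) f(z) g(z)̄ (i/2) dz ∧ dz̄`. -/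
def hE (δ : ℕ) [NeZero δ] (τ : ℍ) (Φ : ℂ × ℂ → ℂ) (μ : ℂ) (f g : ℂ → ℂ) : ℂ :=
  ∫ z in parallelogram δ τ, (hETilde δ τ Φ (z, μ) : ℂ) * f z * conj (g z)

/-- The Gram matrix of a frame of `E` with respect to `h_E`. -/
def gram (δ : ℕ) [NeZero δ] (τ : ℍ) (Φ : ℂ × ℂ → ℂ) {n : ℕ} (s : Fin n → ℂ × ℂ → ℂ) (μ : ℂ) :
    Matrix (Fin n) (Fin n) ℂ :=
  Matrix.of fun i j => hE δ τ Φ μ (fun z => s i (z, μ)) (fun z => s j (z, μ))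

end DirectImage

end AdiabaticTorus

end

/-! The metric is flat up to an explicit scalar, and only that scalar is curved. The function
`stdIdentification`, exp(2πi μ z₂/τ₂), solves the ∂̄-equation of the gauge bundle. By
`exists_comparison` every Φ is g times it, where g is a nowhere zero holomorphic isomorphism from P
to `stdPoincare`. Completing the square (`hETilde_eq`) gives h_Ẽ(z, μ) = exp(2π μ₂²/τ₂) h_{L₀}(z +
μ) |g|². So multiplication by g followed by translation by μ (`fibreEquiv`) maps every fibre of E
onto the fixed space H⁰(M, L₀) and turns h_E into exp(2π μ₂²/τ₂) times a fixed inner product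
(`hE_eq`).

That space has the theta functions of level δ as a basis: they are independent as eigenvectors of
the translation by 1, and Fourier coefficients bound the dimension by δ. Transporting them back
gives local frames of E. In this basis any frame has a holomorphic invertible coefficient matrix A,
so its Gram matrix is exp(c μ₂²) A C A* with C constant and c = 2π/τ₂ (`gram_eq`). The factors A and
C contribute no curvature; what remains is ∂̄∂(c μ₂²) = -(c/2) dμ ∧ dμ̄ (`chernCurvature_eq`). -/

namespace AdiabaticTorus

/-! ### Theta functions of level δ and the dimension of H⁰(M, L₀) -/

section ThetaFunctions

-- Reindexing the series by n ↦ n + b completes the square in the exponent; the shift by a only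
-- contributes exp(2πi n a) = 1.
open Complex Real in
theorem jacobiTheta₂_add_lattice (z τ : ℂ) (a b : ℤ) :
    jacobiTheta₂ (z + a + b * τ) τ =
      cexp (-π * I * (b ^ 2 * τ + 2 * b * z)) * jacobiTheta₂ z τ := by
  rw [jacobiTheta₂, jacobiTheta₂, ← tsum_mul_left,
    ← (Equiv.addRight b).tsum_eq (fun n => _ * jacobiTheta₂_term n z τ)]
  refine tsum_congr fun n => ?_
  simp only [jacobiTheta₂_term, Equiv.coe_addRight, ← Complex.exp_add]
  rw [Complex.exp_eq_exp_iff_exists_int]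
  refine ⟨n * a, ?_⟩
  push_cast
  ring

open Complex Real in
/-- The zeroth Fourier coefficient of the theta function is `1`. -/
theorem integral_jacobiTheta₂ (τ : ℍ) : ∫ x in (0 : ℝ)..1, jacobiTheta₂ x τ = 1 := by
  -- For real x the norm of a term does not depend on x, so the series at 0 dominates and may be
  -- integrated termwise.
  have hterm : ∀ (n : ℤ) (x : ℝ), ‖jacobiTheta₂_term n x τ‖ = ‖jacobiTheta₂_term n 0 τ‖ := by
    intro n x
    simp [norm_jacobiTheta₂_term]
  have hs := (intervalIntegral.hasSum_integral_of_dominated_convergence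
    (μ := MeasureTheory.volume) (a := 0) (b := 1)
    (F := fun (n : ℤ) (x : ℝ) => jacobiTheta₂_term n x τ) (f := fun x => jacobiTheta₂ x τ)
    (fun n _ => ‖jacobiTheta₂_term n 0 τ‖)
    (fun n => by
      apply Continuous.aestronglyMeasurable
      simp only [jacobiTheta₂_term]; fun_prop)
    (fun n => Filter.Eventually.of_forall fun x _ => (hterm n x).le)
    (Filter.Eventually.of_forall fun x _ =>
      ((summable_jacobiTheta₂_term_iff 0 τ).2 τ.im_pos).norm)
    (by simp)
    (Filter.Eventually.of_forall fun x _ => hasSum_jacobiTheta₂_term x τ.im_pos))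
  refine hs.unique ?_
  have : ∀ n : ℤ, ∫ x in (0 : ℝ)..1, jacobiTheta₂_term n x τ = if n = 0 then 1 else 0 := by
    intro n
    split_ifs with h
    · simp [h, jacobiTheta₂_term]
    · simp only [jacobiTheta₂_term, Complex.exp_add, intervalIntegral.integral_mul_const]
      have hc : 2 * π * I * n ≠ 0 := by simp [h, Real.pi_ne_zero]
      rw [integral_exp_mul_complex hc]
      have : cexp (2 * π * I * n * (1 : ℝ)) = 1 := by
        rw [Complex.exp_eq_one_iff]; exact ⟨n, by push_cast; ring⟩
      rw [this]; simp
  simp_rw [this]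
  exact hasSum_ite_eq 0 1

/-- The classical theta functions of level `δ`. -/
noncomputable def theta (δ : ℕ) (τ : ℍ) (j : Fin δ) (w : ℂ) : ℂ :=
  Complex.exp (2 * Real.pi * Complex.I * (j : ℂ) * w / δ) *
    jacobiTheta₂ (w + (j : ℂ) * τ / δ) τ

theorem differentiable_theta (δ : ℕ) (τ : ℍ) (j : Fin δ) : Differentiable ℂ (theta δ τ j) := by
  intro w
  have h : DifferentiableAt ℂ (fun w : ℂ => jacobiTheta₂ (w + (j : ℂ) * τ / δ) τ) w :=
    (differentiableAt_jacobiTheta₂_fst _ τ.im_pos).comp w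
      (f := fun w : ℂ => w + (j : ℂ) * τ / δ) (by fun_prop)
  unfold theta
  fun_prop

variable (δ : ℕ) (τ : ℍ)

theorem theta_mem_H0 [NeZero δ] (j : Fin δ) : theta δ τ j ∈ (L0 δ τ).H0 := by
  refine ⟨differentiable_theta δ τ j, fun a w => ?_⟩
  have hδ : (δ : ℂ) ≠ 0 := NeZero.ne _
  have h := jacobiTheta₂_add_lattice (w + (j : ℂ) * τ / δ) τ (a.1 * δ) a.2
  have e : w + period δ τ a + (j : ℂ) * τ / δ =
      w + (j : ℂ) * τ / δ + ((a.1 * δ : ℤ) : ℂ) + a.2 * τ := by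
    simp [period]; ring
  rw [theta, e, h, theta, L0, ← mul_assoc, ← mul_assoc, ← Complex.exp_add, ← Complex.exp_add]
  congr 1
  rw [Complex.exp_eq_exp_iff_exists_int]
  -- The prefactor gains exp(2πi j a₁) = 1 from a₁δ. What it gains from a₂τ cancels the surplus
  -- caused by the offset jτ/δ in the argument of the theta function.
  refine ⟨j * a.1, ?_⟩
  simp only [period, AddMonoidHom.coe_mk, ZeroHom.coe_mk]
  push_cast
  field_simp
  ring

/-- Otherwise the Jacobi theta function would vanish identically, although its zeroth Fourier
coefficient is 1. -/
theorem theta_ne_zero (j : Fin δ) : theta δ τ j ≠ 0 := by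
  intro h
  have h0 : ∀ w, jacobiTheta₂ w τ = 0 := by
    intro w
    have := congrFun h (w - (j : ℂ) * τ / δ)
    simpa [theta, Complex.exp_ne_zero] using this
  have := integral_jacobiTheta₂ τ
  simp [h0] at this

/-- Translation of functions by `1`. -/
noncomputable def shiftOne : Module.End ℂ (ℂ → ℂ) := LinearMap.funLeft ℂ ℂ (fun w : ℂ => w + 1)

/-- Translation by 1 multiplies the j-th function by exp(2πi/δ)^j, and these eigenvalues are
distinct for j < δ. -/
theorem linearIndependent_theta [NeZero δ] : LinearIndependent ℂ (theta δ τ) := by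
  have hδ : (δ : ℂ) ≠ 0 := NeZero.ne _
  refine Module.End.eigenvectors_linearIndependent' shiftOne
    (fun j : Fin δ => Complex.exp (2 * Real.pi * Complex.I / δ) ^ (j : ℕ)) ?_ _ fun j => ?_
  · intro i j hij
    exact Fin.ext ((Complex.isPrimitiveRoot_exp δ (NeZero.ne _)).pow_inj i.2 j.2 hij)
  · rw [Module.End.hasEigenvector_iff, Module.End.mem_eigenspace_iff]
    refine ⟨?_, theta_ne_zero δ τ j⟩
    ext w
    have h := jacobiTheta₂_add_left (w + (j : ℂ) * τ / δ) τ
    simp only [shiftOne, LinearMap.funLeft_apply, Pi.smul_apply, smul_eq_mul, theta]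
    rw [← Complex.exp_nat_mul, ← mul_assoc, ← Complex.exp_add, add_right_comm, h]
    congr 2
    field_simp
    ring

/-- The integral of an entire periodic function over a period is invariant under translation. -/
theorem integral_period_translate {F : ℂ → ℂ} (hF : Differentiable ℂ F) {T : ℝ}
    (hT : ∀ z, F (z + T) = F z) (w : ℂ) :
    ∫ x in (0 : ℝ)..T, F (x + w) = ∫ x in (0 : ℝ)..T, F x := by
  -- Cauchy's theorem handles the imaginary part of w: the vertical sides cancel by periodicity. The
  -- real part is then a shift of the period interval.
  have h := Complex.integral_boundary_rect_eq_zero_of_differentiableOn F 0 (T + w.im * Complex.I)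
    hF.differentiableOn
  have e : ∀ y : ℝ, F (T + y * Complex.I) = F (y * Complex.I) := fun y => by
    rw [add_comm, hT]
  simp [e] at h
  have hp : Function.Periodic (fun x : ℝ => F (x + w.im * Complex.I)) T := by
    intro x
    simp only
    rw [← hT (x + w.im * Complex.I)]
    congr 1; push_cast; ring
  rw [sub_eq_zero.1 h]
  have h2 := hp.intervalIntegral_add_eq w.re 0
  have h3 := intervalIntegral.integral_comp_add_right (a := 0) (b := T)
    (fun x : ℝ => F (x + w.im * Complex.I)) w.re
  rw [zero_add] at h2 h3
  rw [← h2, add_comm w.re T, ← h3]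
  refine intervalIntegral.integral_congr fun x _ => ?_
  congr 1
  conv_lhs => rw [← Complex.re_add_im w]
  push_cast; ring

/-- The `n`-th Fourier coefficient along the real axis of a function with period `δ`, up to the
factor `1 / δ`. -/
noncomputable def fourierInt (n : ℤ) (f : ℂ → ℂ) : ℂ :=
  ∫ x in (0 : ℝ)..δ, Complex.exp (-(2 * Real.pi * Complex.I * n * x / δ)) * f x

variable {δ τ}

theorem H0_periodic {f : ℂ → ℂ} (hf : f ∈ (L0 δ τ).H0) (z : ℂ) : f (z + δ) = f z := by
  simpa [period, L0] using hf.2 (1, 0) z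

theorem H0_quasiPeriodic {f : ℂ → ℂ} (hf : f ∈ (L0 δ τ).H0) (z : ℂ) :
    f (z + τ) = Complex.exp (-2 * Real.pi * Complex.I * z - Real.pi * Complex.I * τ) * f z := by
  simpa [period, L0] using hf.2 (0, 1) z

/-- Move the contour by τ: the factor exp(-2πi z) in the quasi-periodicity raises the Fourier index
by δ. -/
theorem fourierInt_add_level [NeZero δ] {f : ℂ → ℂ} (hf : f ∈ (L0 δ τ).H0) (n : ℤ) :
    fourierInt δ (n + δ) f =
      Complex.exp (Real.pi * Complex.I * τ + 2 * Real.pi * Complex.I * n * τ / δ) *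
        fourierInt δ n f := by
  have hδ : (δ : ℂ) ≠ 0 := NeZero.ne _
  have h := integral_period_translate (T := δ)
    (F := fun z => Complex.exp (-(2 * Real.pi * Complex.I * n * z / δ)) * f z)
    (by have := hf.1; fun_prop)
    (fun z => by
      push_cast
      rw [H0_periodic hf, mul_add, add_div, mul_div_cancel_right₀ _ hδ, neg_add, Complex.exp_add]
      congr 1
      convert mul_one _ using 2
      rw [Complex.exp_eq_one_iff]; exact ⟨-n, by push_cast; ring⟩) τ
  rw [fourierInt, fourierInt, ← h, ← intervalIntegral.integral_const_mul]
  refine intervalIntegral.integral_congr fun x _ => ?_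
  simp only [H0_quasiPeriodic hf, ← mul_assoc, ← Complex.exp_add]
  congr 2
  push_cast
  field_simp
  ring

/-- The recursion of step δ has nonzero factors, so vanishing propagates in both directions through
each residue class mod δ. -/
theorem fourierInt_eq_zero [NeZero δ] {f : ℂ → ℂ} (hf : f ∈ (L0 δ τ).H0)
    (h : ∀ j : Fin δ, fourierInt δ (j : ℤ) f = 0) (n : ℤ) : fourierInt δ n f = 0 := by
  have hstep : ∀ n : ℤ, fourierInt δ (n + δ) f = 0 ↔ fourierInt δ n f = 0 := fun n => by
    rw [fourierInt_add_level hf, mul_eq_zero, or_iff_right (Complex.exp_ne_zero _)]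
  have hk : ∀ (k : ℤ) (n : ℤ), fourierInt δ (n + k * δ) f = 0 ↔ fourierInt δ n f = 0 := by
    intro k
    induction k using Int.induction_on with
    | zero => simp
    | succ k ih => intro n; rw [add_mul, one_mul, ← add_assoc, hstep, ih]
    | pred k ih =>
      intro n
      rw [← hstep, sub_mul, one_mul, ← add_sub_assoc, sub_add_cancel, ih]
  have hδ : (0 : ℤ) < δ := by exact_mod_cast Nat.pos_of_neZero δ
  have h1 := Int.emod_nonneg n hδ.ne'
  have h2 := Int.emod_lt_of_pos n hδ
  have h3 := h ⟨(n % δ).toNat, by omega⟩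
  rw [← Int.emod_add_ediv_mul n δ, hk]
  simpa [Int.toNat_of_nonneg h1] using h3

/-- A section of `L₀` whose Fourier coefficients of index `0, …, δ - 1` vanish is zero. -/
theorem H0_eq_zero [NeZero δ] {f : ℂ → ℂ} (hf : f ∈ (L0 δ τ).H0)
    (h : ∀ j : Fin δ, fourierInt δ (j : ℤ) f = 0) : f = 0 := by
  have hδ : (0 : ℝ) < δ := by exact_mod_cast Nat.pos_of_neZero δ
  have : Fact ((0 : ℝ) < δ) := ⟨hδ⟩
  have hp : Function.Periodic (fun x : ℝ => f x) δ := fun x => by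
    simpa using H0_periodic hf x
  have hc : Continuous (fun x : ℝ => f x) := hf.1.continuous.comp Complex.continuous_ofReal
  let F : C(AddCircle (δ : ℝ), ℂ) := ⟨hp.lift, continuous_coinduced_dom.mpr hc⟩
  have hF : ∀ x : ℝ, F (x : AddCircle (δ : ℝ)) = f x := fun x => rfl
  have hcoef : ∀ n, fourierCoeff F n = 0 := by
    intro n
    rw [fourierCoeff_eq_intervalIntegral _ _ 0, zero_add]
    convert smul_zero _
    rw [← fourierInt_eq_zero hf h n]
    refine intervalIntegral.integral_congr fun x _ => ?_
    simp only [fourier_coe_apply, hF, smul_eq_mul]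
    congr 2
    push_cast; ring
  -- All coefficients vanish, hence are summable, so the Fourier series converges to the continuous
  -- function F with no further regularity.
  have hsum : HasSum (fun i => fourierCoeff F i • fourier i) F :=
    hasSum_fourier_series_of_summable (by simp only [funext hcoef]; exact summable_zero)
  have hF0 : F = 0 := by
    simp only [hcoef, zero_smul] at hsum
    exact hsum.unique hasSum_zero
  have hreal : ∀ x : ℝ, f x = 0 := fun x => by rw [← hF, hF0]; rfl
  have han : AnalyticOnNhd ℂ f Set.univ :=
    hf.1.differentiableOn.analyticOnNhd isOpen_univ
  -- Identity theorem: f vanishes on the real axis, which accumulates at 0.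
  refine han.eq_of_frequently_eq analyticOnNhd_const (z₀ := 0) ?_
  have ht : Filter.Tendsto (fun x : ℝ => (x : ℂ)) (nhdsWithin 0 {0}ᶜ) (nhdsWithin 0 {0}ᶜ) := by
    refine tendsto_nhdsWithin_iff.2 ⟨?_, ?_⟩
    · exact (Complex.continuous_ofReal.tendsto' 0 0 (by simp)).mono_left nhdsWithin_le_nhds
    · filter_upwards [self_mem_nhdsWithin] with x hx
      simpa using hx
  exact ht.frequently (Filter.Frequently.of_forall fun x => by simpa using hreal x)

theorem intervalIntegrable_fourier {f : ℂ → ℂ} (hf : Differentiable ℂ f) (n : ℤ) :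
    IntervalIntegrable (fun x : ℝ =>
      Complex.exp (-(2 * Real.pi * Complex.I * n * x / δ)) * f x) MeasureTheory.volume 0 δ := by
  apply Continuous.intervalIntegrable
  have := hf.continuous
  fun_prop

variable (δ τ)

/-- The first `δ` Fourier coefficients as a linear map on `H⁰(M, L₀)`. -/
noncomputable def fourierMap : (L0 δ τ).H0 →ₗ[ℂ] Fin δ → ℂ where
  toFun f j := fourierInt δ (j : ℤ) f
  map_add' f g := by
    ext j
    simp only [fourierInt, Submodule.coe_add, Pi.add_apply, mul_add]
    exact intervalIntegral.integral_add (intervalIntegrable_fourier f.2.1 _)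
      (intervalIntegrable_fourier g.2.1 _)
  map_smul' c f := by
    ext j
    simp only [fourierInt, Submodule.coe_smul, Pi.smul_apply, smul_eq_mul, RingHom.id_apply,
      ← intervalIntegral.integral_const_mul]
    refine intervalIntegral.integral_congr fun x _ => ?_
    ring

theorem fourierMap_injective [NeZero δ] : Function.Injective (fourierMap δ τ) := by
  rw [← LinearMap.ker_eq_bot, LinearMap.ker_eq_bot']
  intro f hf
  exact Subtype.ext (H0_eq_zero f.2 fun j => congrFun hf j)

instance [NeZero δ] : FiniteDimensional ℂ (L0 δ τ).H0 :=
  FiniteDimensional.of_injective _ (fourierMap_injective δ τ)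

/-- The injective Fourier map gives the upper bound, the independent theta functions the lower one.
-/
theorem finrank_H0 [NeZero δ] : Module.finrank ℂ (L0 δ τ).H0 = δ := by
  apply le_antisymm
  · simpa using LinearMap.finrank_le_finrank_of_injective (fourierMap_injective δ τ)
  · have hli : LinearIndependent ℂ
        (fun j => (⟨theta δ τ j, theta_mem_H0 δ τ j⟩ : (L0 δ τ).H0)) :=
      LinearIndependent.of_comp (L0 δ τ).H0.subtype (linearIndependent_theta δ τ)
    simpa using hli.fintype_card_le_finrank

theorem span_theta [NeZero δ] : Submodule.span ℂ (Set.range (theta δ τ)) = (L0 δ τ).H0 := by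
  apply Submodule.eq_of_le_of_finrank_eq
  · rw [Submodule.span_le]; rintro _ ⟨j, rfl⟩; exact theta_mem_H0 δ τ j
  · rw [finrank_H0, finrank_span_eq_card (linearIndependent_theta δ τ), Fintype.card_fin]

/-- The coordinates with respect to finitely many linearly independent functions are finite linear
combinations of point evaluations. -/
theorem exists_evaluation_coeff {ι X : Type*} [Finite ι] [DecidableEq ι] {f : ι → X → ℂ}
    (hf : LinearIndependent ℂ f) (i : ι) :
    ∃ c : X →₀ ℂ, ∀ j, (c.sum fun x a => a * f j x) = if j = i then 1 else 0 := by
  have := Fintype.ofFinite ι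
  -- If the value vectors (f j x)ⱼ did not span, a nonzero functional would annihilate all of them,
  -- and its coordinates would be a linear relation among the f j.
  have htop : Submodule.span ℂ (Set.range fun (x : X) (j : ι) => f j x) = ⊤ := by
    by_contra hne
    obtain ⟨φ, hφ0, hφ⟩ := Submodule.exists_le_ker_of_lt_top _ (lt_top_iff_ne_top.2 hne)
    apply hφ0
    have hφx : ∀ x, ∑ j, φ (Pi.single j 1) * f j x = 0 := by
      intro x
      have h1 : φ (fun j => f j x) = 0 :=
        hφ (Submodule.subset_span ⟨x, rfl⟩)
      rw [LinearMap.pi_apply_eq_sum_univ φ] at h1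
      rw [← h1]
      refine Finset.sum_congr rfl fun j _ => ?_
      rw [smul_eq_mul, mul_comm]
      congr 2
      ext k
      simp [Pi.single_apply, eq_comm]
    have h2 := Fintype.linearIndependent_iff.1 hf (fun j => φ (Pi.single j 1))
      (by ext x; simpa using hφx x)
    refine LinearMap.pi_ext' fun j => ?_
    ext
    simpa using h2 j
  have hmem : (Pi.single i 1 : ι → ℂ) ∈
      Submodule.span ℂ (Set.range fun (x : X) (j : ι) => f j x) := by rw [htop]; trivial
  obtain ⟨c, hc⟩ := Finsupp.mem_span_range_iff_exists_finsupp.1 hmem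
  refine ⟨c, fun j => ?_⟩
  have := congrFun hc j
  simpa [Finsupp.sum, Pi.single_apply] using this

end ThetaFunctions

/-! ### The explicit Poincaré bundle and the comparison of identifications -/

section Identification

/-- A real differentiable function whose derivative commutes with multiplication by `i` is
complex differentiable. -/
theorem differentiableAt_complex_of_fderiv_I {W : Type*} [NormedAddCommGroup W] [NormedSpace ℂ W]
    {f : W → ℂ} {w : W} (hf : DifferentiableAt ℝ f w)
    (h : ∀ v, fderiv ℝ f w v + Complex.I * fderiv ℝ f w (Complex.I • v) = 0) :
    DifferentiableAt ℂ f w := by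
  have hI : ∀ v, fderiv ℝ f w (Complex.I • v) = Complex.I * fderiv ℝ f w v := fun v => by
    linear_combination (-Complex.I) * h v + fderiv ℝ f w (Complex.I • v) * Complex.I_sq
  let L : W →L[ℂ] ℂ :=
    { toFun := fderiv ℝ f w
      map_add' := map_add _
      map_smul' := fun c v => by
        have hc : c • v = c.re • v + c.im • (Complex.I • v) := by
          conv_lhs => rw [← Complex.re_add_im c]
          rw [add_smul, mul_smul, Complex.coe_smul, Complex.coe_smul]
        rw [hc, map_add, map_smul, map_smul, hI, RingHom.id_apply, smul_eq_mul,
          Complex.real_smul, Complex.real_smul]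
        conv_rhs => rw [← Complex.re_add_im c]
        ring
      cont := (fderiv ℝ f w).continuous }
  exact (hasFDerivAt_of_restrictScalars ℝ (f' := L) hf.hasFDerivAt rfl).differentiableAt

variable (δ : ℕ) (τ : ℍ)

/-- The Poincaré bundle with multipliers `exp (-2πi (m₂ z / δ + a₂ μ̂ + a₂ m₂ τ / δ))`. -/
noncomputable def stdPoincare [NeZero δ] : HolLineBundle (prodPeriod δ τ) where
  mult γ w := Complex.exp (-2 * Real.pi * Complex.I *
    (γ.2.2 * w.1 / δ + γ.1.2 * w.2 + γ.1.2 * γ.2.2 * τ / δ))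
  holo γ := by fun_prop
  ne_zero _ _ := Complex.exp_ne_zero _
  cocycle γ γ' w := by
    have hδ : (δ : ℂ) ≠ 0 := NeZero.ne _
    rw [← Complex.exp_add, Complex.exp_eq_exp_iff_exists_int]
    -- The integral parts of m₂λ'/δ and a₂λ̂', for the shifts λ' of z and λ̂' of μ; the multiples of
    -- τ/δ are absorbed by the term a₂m₂τ/δ of the multiplier.
    refine ⟨γ.2.2 * γ'.1.1 + γ.1.2 * γ'.2.1, ?_⟩
    simp only [prodPeriod, period, dualPeriod, AddMonoidHom.prodMap_def, AddMonoidHom.prod_apply,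
      AddMonoidHom.comp_apply, AddMonoidHom.coe_mk, ZeroHom.coe_mk,
      AddMonoidHom.coe_fst, AddMonoidHom.coe_snd, Prod.fst_add, Prod.snd_add]
    push_cast
    field_simp
    ring

/-- The identification `exp (2πi μ̂ z₂ / τ₂)` of `stdPoincare` with the gauge-theoretic Poincaré
bundle. -/
noncomputable def stdIdentification (w : ℂ × ℂ) : ℂ :=
  Complex.exp (2 * Real.pi * Complex.I * w.2 * (w.1.im / τ.im : ℝ))

theorem gaugePullback_mult [NeZero δ] (γ : (ℤ × ℤ) × (ℤ × ℤ)) (w : ℂ × ℂ) :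
    (gaugePullback δ τ).mult γ w = Complex.exp (-2 * Real.pi * Complex.I *
      ((γ.2.2 * dx1 δ τ w.1 - γ.2.1 * dx2 τ w.1 : ℝ) : ℂ)) := by
  simp [gaugePullback, GaugeLineBundle.pullback, gaugePoincare, isoLattice,
    AddMonoidHom.prodMap_def, sub_eq_add_neg]

theorem norm_gaugePullback_mult [NeZero δ] (γ : (ℤ × ℤ) × (ℤ × ℤ)) (w : ℂ × ℂ) :
    ‖(gaugePullback δ τ).mult γ w‖ = 1 := by
  rw [gaugePullback_mult, Complex.norm_exp]
  simp

theorem gaugePullback_metric [NeZero δ] (w : ℂ × ℂ) : (gaugePullback δ τ).metric w = 1 := rfl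

/-- In the expansion along dx₁, dx₂ both δ and τ₁ cancel, leaving ξ(v) = (2π/τ₂) Im(μ v̄). -/
theorem gaugePullback_conn [NeZero δ] (w v : ℂ × ℂ) :
    (gaugePullback δ τ).conn w v =
      Complex.I * ((2 * Real.pi / τ.im * (w.2.im * v.1.re - w.2.re * v.1.im) : ℝ) : ℂ) := by
  have hδ : (δ : ℝ) ≠ 0 := NeZero.ne _
  have hτ : τ.im ≠ 0 := τ.im_pos.ne'
  have : (isoLift δ τ w.2) v.1 =
      2 * Real.pi / τ.im * (w.2.im * v.1.re - w.2.re * v.1.im) := by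
    simp [isoLift, dx1, dx2]
    field_simp
    ring
  rw [← this]
  rfl

theorem gaugePullback_conn_dbar [NeZero δ] (w v : ℂ × ℂ) :
    (gaugePullback δ τ).conn w v + Complex.I * (gaugePullback δ τ).conn w (Complex.I • v) =
      2 * Real.pi / τ.im * w.2 * conj v.1 := by
  rw [gaugePullback_conn, gaugePullback_conn]
  have hτ : τ.im ≠ 0 := τ.im_pos.ne'
  apply Complex.ext
  · simp; field_simp; ring
  · simp; field_simp; ring

theorem stdIdentification_ne_zero (w : ℂ × ℂ) : stdIdentification τ w ≠ 0 := Complex.exp_ne_zero _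

theorem contDiff_stdIdentification : ContDiff ℝ ∞ (stdIdentification τ) := by
  have h : ContDiff ℝ ∞ fun w : ℂ × ℂ => ((w.1.im / τ.im : ℝ) : ℂ) :=
    Complex.ofRealCLM.contDiff.comp ((Complex.imCLM.contDiff.comp contDiff_fst).div_const _)
  exact ((contDiff_const.mul contDiff_snd).mul h).cexp

theorem fderiv_stdIdentification (w v : ℂ × ℂ) :
    fderiv ℝ (stdIdentification τ) w v = stdIdentification τ w *
      (2 * Real.pi * Complex.I / τ.im * (v.2 * w.1.im + w.2 * v.1.im)) := by
  have h : HasFDerivAt (fun w : ℂ × ℂ => ((w.1.im / τ.im : ℝ) : ℂ))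
      (Complex.ofRealCLM.comp ((1 / τ.im) • (Complex.imCLM.comp
      (ContinuousLinearMap.fst ℝ ℂ ℂ)))) w := by
    refine (Complex.ofRealCLM.comp ((1 / τ.im) • (Complex.imCLM.comp
      (ContinuousLinearMap.fst ℝ ℂ ℂ)))).hasFDerivAt.congr_of_eventuallyEq ?_
    exact Filter.Eventually.of_forall fun w => by simp; ring
  have h2 : HasFDerivAt (stdIdentification τ) _ w :=
    (((hasFDerivAt_snd (𝕜 := ℝ) (p := w)).const_mul (2 * Real.pi * Complex.I)).mul h).cexp
  rw [h2.fderiv]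
  simp [stdIdentification]
  ring

/-- The exponent 2πi μ z₂/τ₂ is holomorphic in μ, and its z̄-derivative is the negative of the
(0,1)-part found in `gaugePullback_conn_dbar`. -/
theorem dbar_stdIdentification [NeZero δ] (w v : ℂ × ℂ) :
    (gaugePullback δ τ).nabla (stdIdentification τ) w v +
      Complex.I * (gaugePullback δ τ).nabla (stdIdentification τ) w (Complex.I • v) = 0 := by
  have h := gaugePullback_conn_dbar δ τ w v
  simp only [GaugeLineBundle.nabla, fderiv_stdIdentification]
  have hc : conj v.1 = v.1.re - v.1.im * Complex.I := by
    apply Complex.ext <;> simp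
  rw [hc] at h
  simp only [Prod.smul_fst, Prod.smul_snd, smul_eq_mul, Complex.I_mul_im]
  linear_combination (stdIdentification τ w) * h +
    (stdIdentification τ w * (2 * Real.pi * Complex.I / τ.im * v.2 * w.1.im) +
      stdIdentification τ w * (2 * Real.pi / τ.im * w.2 * v.1.re)) * Complex.I_sq

variable [NeZero δ]

theorem isIdentification_std :
    GaugeLineBundle.IsIdentification (stdPoincare δ τ) (gaugePullback δ τ)
      (stdIdentification τ) where
  smooth := contDiff_stdIdentification τ
  ne_zero := stdIdentification_ne_zero τ
  equivariant γ w := by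
    have hδ : (δ : ℂ) ≠ 0 := NeZero.ne _
    have hτ : (τ.im : ℂ) ≠ 0 := by exact_mod_cast τ.im_pos.ne'
    have hw : (w.1 : ℂ) = w.1.re + w.1.im * Complex.I := (Complex.re_add_im _).symm
    have hτ' : (τ : ℂ) = τ.re + τ.im * Complex.I := (Complex.re_add_im _).symm
    have him : (period δ τ γ.1).im = γ.1.2 * τ.im := by simp [period]
    rw [gaugePullback_mult, stdPoincare, stdIdentification, stdIdentification,
      ← Complex.exp_add, ← Complex.exp_add, Complex.exp_eq_exp_iff_exists_int]
    -- The integer a₂m₁ is the product of the shift m₁ of μ and the shift a₂ of z₂/τ₂.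
    refine ⟨γ.1.2 * γ.2.1, ?_⟩
    simp only [prodPeriod, dualPeriod, AddMonoidHom.prodMap_def, AddMonoidHom.prod_apply,
      AddMonoidHom.comp_apply, AddMonoidHom.coe_mk, ZeroHom.coe_mk, AddMonoidHom.coe_fst,
      AddMonoidHom.coe_snd, Prod.fst_add, Prod.snd_add, Complex.add_im, him, dx1, dx2]
    simp only [smul_apply, sub_apply,
      Complex.reCLM_apply, Complex.imCLM_apply, smul_eq_mul]
    push_cast
    generalize (w.1.re : ℂ) = x at *
    generalize (w.1.im : ℂ) = y at *
    rw [hw, hτ']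
    field_simp
    ring
  dbar := dbar_stdIdentification δ τ

theorem isPoincare_std : IsPoincare (stdPoincare δ τ) where
  restrict μ := by
    have hτ : (τ.im : ℂ) ≠ 0 := by exact_mod_cast τ.im_pos.ne'
    have hc : conj (τ : ℂ) = (τ : ℂ) - 2 * τ.im * Complex.I := by
      apply Complex.ext <;> simp; ring
    -- The multipliers of `picBundle` are exp(πμ λ̄/τ₂); as λ - λ̄ = 2i a₂τ₂, this factor relates
    -- them to exp(-2πi a₂ μ).
    refine ⟨fun z => Complex.exp (Real.pi * μ / τ.im * z), by fun_prop,
      fun _ => Complex.exp_ne_zero _, fun a z => ?_⟩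
    simp only [restrictM, HolLineBundle.pullback, stdPoincare, picBundle, e1Star,
      AddMonoidHom.inl_apply, Prod.snd_zero, Int.cast_zero, zero_mul, zero_div,
      mul_zero, add_zero, zero_add, ← Complex.exp_add, period, AddMonoidHom.coe_mk,
      ZeroHom.coe_mk, map_add, map_mul, Complex.conj_natCast, map_intCast, hc]
    congr 1
    field_simp
    ring_nf
    simp only [Complex.I_pow_three, Complex.I_sq]
    ring
  normalized := ⟨fun _ => 1, differentiable_const _, fun _ => one_ne_zero, fun m μ => by
    simp [restrictMHat, HolLineBundle.pullback, stdPoincare, HolLineBundle.trivial]⟩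

variable {δ τ}

/-- An identification differs from the standard one by an isomorphism of holomorphic line
bundles. -/
theorem exists_comparison {P : HolLineBundle (prodPeriod δ τ)} {Φ : ℂ × ℂ → ℂ}
    (hΦ : GaugeLineBundle.IsIdentification P (gaugePullback δ τ) Φ) :
    ∃ g : ℂ × ℂ → ℂ, Differentiable ℂ g ∧ (∀ w, g w ≠ 0) ∧
      (∀ w, Φ w = g w * stdIdentification τ w) ∧
      ∀ γ w, g (w + prodPeriod δ τ γ) * P.mult γ w = (stdPoincare δ τ).mult γ w * g w := by
  have hne := stdIdentification_ne_zero τ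
  set g : ℂ × ℂ → ℂ := fun w => Φ w / stdIdentification τ w with hg
  have hmul : ∀ w, Φ w = g w * stdIdentification τ w := fun w => (div_mul_cancel₀ _ (hne w)).symm
  have hgd : ∀ w, DifferentiableAt ℝ g w := fun w =>
    ((hΦ.smooth.mul ((contDiff_stdIdentification τ).inv hne)).differentiable (by simp)) w
  refine ⟨g, fun w => differentiableAt_complex_of_fderiv_I (hgd w) fun v => ?_,
    fun w => div_ne_zero (hΦ.ne_zero w) (hne w), hmul, fun γ w => ?_⟩
  · have hd : ∀ v, fderiv ℝ Φ w v =
        g w * fderiv ℝ (stdIdentification τ) w v + stdIdentification τ w * fderiv ℝ g w v := by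
      intro v
      rw [show Φ = fun w => g w * stdIdentification τ w from funext hmul,
        fderiv_fun_mul (hgd w) (((contDiff_stdIdentification τ).differentiable (by simp)) w)]
      simp
    have h1 := hΦ.dbar w v
    have h2 := dbar_stdIdentification δ τ w v
    simp only [GaugeLineBundle.nabla, hd, hmul w] at h1 h2
    have h3 : stdIdentification τ w *
        (fderiv ℝ g w v + Complex.I * fderiv ℝ g w (Complex.I • v)) = 0 := by
      -- By the Leibniz rule the connection terms cancel, and only ∂̄g times the standard solution
      -- is left.
      linear_combination h1 - g w * h2
    exact (mul_eq_zero.1 h3).resolve_left (hne w)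
  · have h1 := hΦ.equivariant γ w
    have h2 := (isIdentification_std δ τ).equivariant γ w
    rw [hmul, hmul w] at h1
    apply mul_right_cancel₀ (hne (w + prodPeriod δ τ γ))
    linear_combination h1 - g w * h2

end Identification

open MeasureTheory

/-! ### Integration over the fundamental parallelogram -/

section FundamentalDomain

variable (δ : ℕ) [NeZero δ] (τ : ℍ)

/-- The real basis `δ, τ` of `ℂ`. -/
noncomputable def periodBasis : Module.Basis (Fin 2) ℝ ℂ :=
  Module.Basis.ofEquivFun
    { toFun := fun z => ![dx1 δ τ z, dx2 τ z]
      invFun := fun c => c 0 * δ + c 1 * (τ : ℂ)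
      map_add' := fun z w => by ext i; fin_cases i <;> simp
      map_smul' := fun r z => by rw [map_smul, map_smul]; ext i; fin_cases i <;> rfl
      left_inv := fun z => by
        have hδ : (δ : ℝ) ≠ 0 := NeZero.ne _
        have hτ : τ.im ≠ 0 := τ.im_pos.ne'
        apply Complex.ext
        · simp [dx1, dx2]; field_simp; ring
        · simp [dx2]; field_simp
      right_inv := fun c => by
        have hδ : (δ : ℝ) ≠ 0 := NeZero.ne _
        have hτ : τ.im ≠ 0 := τ.im_pos.ne'
        ext i
        fin_cases i
        · simp [dx1]; field_simp; ring
        · simp [dx2]; field_simp }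

theorem periodBasis_repr (z : ℂ) (i : Fin 2) :
    (periodBasis δ τ).repr z i = ![dx1 δ τ z, dx2 τ z] i := rfl

theorem periodBasis_zero : periodBasis δ τ 0 = δ := by
  rw [periodBasis, Module.Basis.coe_ofEquivFun]
  simp

theorem periodBasis_one : periodBasis δ τ 1 = τ := by
  rw [periodBasis, Module.Basis.coe_ofEquivFun]
  simp

theorem parallelogram_eq : parallelogram δ τ = ZSpan.fundamentalDomain (periodBasis δ τ) := by
  ext z
  rw [ZSpan.mem_fundamentalDomain, Fin.forall_fin_two, periodBasis_repr, periodBasis_repr]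
  have hδ : (δ : ℝ) ≠ 0 := NeZero.ne _
  have hτ : τ.im ≠ 0 := τ.im_pos.ne'
  constructor
  · rintro ⟨a, ha, b, hb, rfl⟩
    have h1 : dx1 δ τ (a * δ + b * (τ : ℂ)) = a := by simp [dx1]; field_simp; ring
    have h2 : dx2 τ (a * δ + b * (τ : ℂ)) = b := by simp [dx2]; field_simp
    simpa [h1, h2] using ⟨ha, hb⟩
  · rintro ⟨h1, h2⟩
    refine ⟨_, h1, _, h2, ?_⟩
    apply Complex.ext
    · simp [dx1, dx2]; field_simp; ring
    · simp [dx2]; field_simp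

theorem measurableSet_parallelogram : MeasurableSet (parallelogram δ τ) := by
  rw [parallelogram_eq]; exact ZSpan.fundamentalDomain_measurableSet _

theorem isBounded_parallelogram : Bornology.IsBounded (parallelogram δ τ) := by
  rw [parallelogram_eq]; exact ZSpan.fundamentalDomain_isBounded _

theorem isAddFundamentalDomain_parallelogram :
    IsAddFundamentalDomain (Submodule.span ℤ (Set.range (periodBasis δ τ))).toAddSubgroup
      (parallelogram δ τ) := by
  rw [parallelogram_eq]; exact ZSpan.isAddFundamentalDomain' _ _

theorem exists_period_of_mem_span {x : ℂ}
    (hx : x ∈ Submodule.span ℤ (Set.range (periodBasis δ τ))) : ∃ a, period δ τ a = x := by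
  have : Submodule.span ℤ (Set.range (periodBasis δ τ)) ≤
      AddSubgroup.toIntSubmodule (period δ τ).range := by
    rw [Submodule.span_le]
    rintro _ ⟨i, rfl⟩
    fin_cases i
    · exact ⟨(1, 0), by simp [period, periodBasis_zero]⟩
    · exact ⟨(0, 1), by simp [period, periodBasis_one]⟩
  exact this hx

instance : Countable (Submodule.span ℤ (Set.range (periodBasis δ τ))).toAddSubgroup :=
  inferInstanceAs (Countable (Submodule.span ℤ (Set.range (periodBasis δ τ))))

variable {δ τ}

theorem integrableOn_parallelogram {E : Type*} [NormedAddCommGroup E] {F : ℂ → E}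
    (hF : Continuous F) : IntegrableOn F (parallelogram δ τ) :=
  (hF.continuousOn.integrableOn_compact (isBounded_parallelogram δ τ).isCompact_closure).mono_set
    subset_closure

-- The parallelogram and its translate by μ are both fundamental domains of Λ, so a Λ-periodic
-- function has the same integral over each.
open scoped Pointwise in
theorem setIntegral_parallelogram_translate {F : ℂ → ℂ}
    (hF : ∀ a z, F (z + period δ τ a) = F z) (μ : ℂ) :
    ∫ z in parallelogram δ τ, F (z + μ) = ∫ z in parallelogram δ τ, F z := by
  have h := isAddFundamentalDomain_parallelogram δ τ
  have h2 := h.vadd_of_comm μ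
  rw [h.setIntegral_eq h2 (f := F) fun g x => by
    obtain ⟨a, ha⟩ := exists_period_of_mem_span δ τ g.2
    rw [← hF a x, ha, add_comm]; rfl]
  have h3 := (measurePreserving_add_right (volume : Measure ℂ) μ).setIntegral_preimage_emb
    (measurableEmbedding_addRight μ) F (μ +ᵥ parallelogram δ τ)
  rw [← h3]
  congr 2
  ext z
  rw [Set.mem_preimage, add_comm, ← vadd_eq_add, Set.vadd_mem_vadd_set_iff]

-- The set where F is nonzero is Λ-invariant, and Λ is countable, so being null in a fundamental
-- domain makes it null.
open scoped Pointwise in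
theorem ae_eq_zero_of_parallelogram {F : ℂ → ℂ} (hF : ∀ a z, F (z + period δ τ a) = 0 ↔ F z = 0)
    (h0 : F =ᵐ[volume.restrict (parallelogram δ τ)] 0) : F =ᵐ[volume] 0 := by
  have h := isAddFundamentalDomain_parallelogram δ τ
  refine h.measure_zero_of_invariant _ (fun g => ?_) ?_
  · obtain ⟨a, ha⟩ := exists_period_of_mem_span δ τ g.2
    ext z
    rw [Set.mem_vadd_set_iff_neg_vadd_mem]
    have h1 := hF a (-g +ᵥ z)
    have h2 : (-g +ᵥ z) + period δ τ a = z := by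
      rw [ha]; change -(g : ℂ) + z + g = z; ring
    rw [h2] at h1
    exact not_congr h1.symm
  · have := (ae_restrict_iff' (measurableSet_parallelogram δ τ)).1 h0
    refine measure_mono_null ?_ this
    rintro z ⟨hz, hz'⟩ hc
    exact hz (hc hz')

end FundamentalDomain

/-! ### The L² inner product on H⁰(M, L₀) -/

section InnerProduct

variable {δ : ℕ} {τ : ℍ}

/-- The squared norm of the multiplier, exp(4π a₂z₂ + 2π a₂²τ₂), is what the Gaussian loses under z₂
↦ z₂ + a₂τ₂. -/
theorem hL0_add_period (a : ℤ × ℤ) (z : ℂ) :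
    hL0 τ (z + period δ τ a) * ‖(L0 δ τ).mult a z‖ ^ 2 = hL0 τ z := by
  have hτ : τ.im ≠ 0 := τ.im_pos.ne'
  have h : ((-2 * Real.pi * Complex.I * a.2 * z - Real.pi * Complex.I * a.2 ^ 2 * (τ : ℂ)).re) =
      2 * Real.pi * a.2 * z.im + Real.pi * a.2 ^ 2 * τ.im := by
    have : (((a.2 : ℂ)) ^ 2) = ((a.2 ^ 2 : ℝ) : ℂ) := by push_cast; rfl
    rw [this]
    simp [-Complex.ofReal_pow]
  rw [hL0, hL0, L0, Complex.norm_exp, h, ← Real.exp_nat_mul, ← Real.exp_add]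
  congr 1
  simp [period]
  field_simp
  ring

theorem hL0_pos (τ : ℍ) (z : ℂ) : 0 < hL0 τ z := Real.exp_pos _

theorem continuous_hL0 (τ : ℍ) : Continuous (hL0 τ) := by
  unfold hL0
  have := Complex.continuous_im
  fun_prop

/-- The `L²` inner product on `H⁰(M, L₀)`. -/
noncomputable def innerL0 (δ : ℕ) (τ : ℍ) (f g : ℂ → ℂ) : ℂ :=
  ∫ z in parallelogram δ τ, (hL0 τ z : ℂ) * f z * conj (g z)

theorem hL0_mul_mul_conj_periodic {f g : ℂ → ℂ} (hf : f ∈ (L0 δ τ).H0) (hg : g ∈ (L0 δ τ).H0)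
    (a : ℤ × ℤ) (z : ℂ) :
    (hL0 τ (z + period δ τ a) : ℂ) * f (z + period δ τ a) * conj (g (z + period δ τ a)) =
      (hL0 τ z : ℂ) * f z * conj (g z) := by
  rw [hf.2, hg.2, ← hL0_add_period a z, map_mul]
  push_cast
  rw [← Complex.mul_conj']
  ring

theorem continuous_hL0_mul_mul_conj {f g : ℂ → ℂ} (hf : f ∈ (L0 δ τ).H0)
    (hg : g ∈ (L0 δ τ).H0) : Continuous fun z => (hL0 τ z : ℂ) * f z * conj (g z) :=
  ((Complex.continuous_ofReal.comp (continuous_hL0 τ)).mul hf.1.continuous).mul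
    (Complex.continuous_conj.comp hg.1.continuous)

theorem innerL0_sum [NeZero δ] {ι : Type*} {s : Finset ι} {f : ι → ℂ → ℂ}
    (hf : ∀ i, f i ∈ (L0 δ τ).H0) (a b : ι → ℂ) :
    innerL0 δ τ (fun z => ∑ i ∈ s, a i * f i z) (fun z => ∑ i ∈ s, b i * f i z) =
      ∑ i ∈ s, ∑ j ∈ s, a i * conj (b j) * innerL0 δ τ (f i) (f j) := by
  have h : ∀ z, (hL0 τ z : ℂ) * (∑ i ∈ s, a i * f i z) * conj (∑ i ∈ s, b i * f i z) =
      ∑ i ∈ s, ∑ j ∈ s, a i * conj (b j) * ((hL0 τ z : ℂ) * f i z * conj (f j z)) := by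
    intro z
    rw [map_sum, mul_assoc, Finset.sum_mul_sum, Finset.mul_sum]
    refine Finset.sum_congr rfl fun i _ => ?_
    rw [Finset.mul_sum]
    refine Finset.sum_congr rfl fun j _ => ?_
    rw [map_mul]
    ring
  have hint : ∀ i j, Integrable (fun z => a i * conj (b j) *
      ((hL0 τ z : ℂ) * f i z * conj (f j z))) (volume.restrict (parallelogram δ τ)) :=
    fun i j => (integrableOn_parallelogram
      (continuous_hL0_mul_mul_conj (hf i) (hf j))).const_mul _
  simp only [innerL0, h]
  rw [integral_finsetSum _ fun i _ => integrable_finsetSum _ fun j _ => hint i j]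
  refine Finset.sum_congr rfl fun i _ => ?_
  rw [integral_finsetSum _ fun j _ => hint i j]
  exact Finset.sum_congr rfl fun j _ => integral_const_mul _ _

theorem innerL0_conj (f g : ℂ → ℂ) : conj (innerL0 δ τ f g) = innerL0 δ τ g f := by
  rw [innerL0, innerL0, ← integral_conj]
  congr 1
  ext z
  simp only [map_mul, Complex.conj_ofReal, Complex.conj_conj]
  ring

theorem innerL0_self_pos [NeZero δ] {f : ℂ → ℂ} (hf : f ∈ (L0 δ τ).H0) (hf0 : f ≠ 0) :
    0 < innerL0 δ τ f f := by
  have hc : Continuous fun z => hL0 τ z * ‖f z‖ ^ 2 :=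
    (continuous_hL0 τ).mul (hf.1.continuous.norm.pow 2)
  have h : innerL0 δ τ f f =
      ((∫ z in parallelogram δ τ, hL0 τ z * ‖f z‖ ^ 2 : ℝ) : ℂ) := by
    rw [innerL0, ← integral_complex_ofReal]
    congr 1
    ext z
    push_cast
    rw [mul_assoc, Complex.mul_conj']
  have hnn : ∀ z, 0 ≤ hL0 τ z * ‖f z‖ ^ 2 := fun z =>
    mul_nonneg (hL0_pos τ z).le (sq_nonneg _)
  rw [h, Complex.zero_lt_real]
  refine lt_of_le_of_ne (integral_nonneg hnn) fun h0 => hf0 ?_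
  have h1 := (integral_eq_zero_iff_of_nonneg hnn (integrableOn_parallelogram hc)).1 h0.symm
  have h2 : f =ᵐ[volume.restrict (parallelogram δ τ)] 0 := by
    filter_upwards [h1] with z hz
    simpa [(hL0_pos τ z).ne'] using hz
  -- Multipliers never vanish, so f = 0 almost everywhere on ℂ, hence everywhere by continuity.
  have h3 := ae_eq_zero_of_parallelogram (fun a z => by
    rw [hf.2, mul_eq_zero, or_iff_right ((L0 δ τ).ne_zero _ _)]) h2
  exact hf.1.continuous.ae_eq_iff_eq volume continuous_zero |>.1 h3

variable (δ τ)

/-- The Gram matrix of the theta functions. -/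
noncomputable def thetaGram : Matrix (Fin δ) (Fin δ) ℂ :=
  Matrix.of fun k l => innerL0 δ τ (theta δ τ k) (theta δ τ l)

theorem posDef_thetaGram [NeZero δ] : (thetaGram δ τ).PosDef := by
  refine Matrix.PosDef.of_dotProduct_mulVec_pos ?_ fun x hx => ?_
  · ext i j
    exact innerL0_conj _ _
  -- The conjugates are needed because the inner product is linear in its first argument, while x* C
  -- x conjugates the row index.
  · set f : ℂ → ℂ := fun z => ∑ i, conj (x i) * theta δ τ i z with hf
    have hfe : f = ∑ i, conj (x i) • theta δ τ i := by ext z; simp [hf]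
    have hmem : f ∈ (L0 δ τ).H0 := by
      rw [hfe]
      exact Submodule.sum_mem _ fun i _ => Submodule.smul_mem _ _ (theta_mem_H0 δ τ i)
    have hne : f ≠ 0 := by
      intro h0
      apply hx
      rw [hfe] at h0
      ext i
      simpa using Fintype.linearIndependent_iff.1 (linearIndependent_theta δ τ) _ h0 i
    have hpos := innerL0_self_pos hmem hne
    rw [hf, innerL0_sum (theta_mem_H0 δ τ)] at hpos
    convert hpos using 1
    simp only [dotProduct, Matrix.mulVec, thetaGram, Matrix.of_apply, Finset.mul_sum, Pi.star_apply,
      Complex.conj_conj]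
    refine Finset.sum_congr rfl fun i _ => Finset.sum_congr rfl fun j _ => ?_
    simp only [RCLike.star_def]
    ring

end InnerProduct

/-! ### Holomorphy of the inverse matrix -/

section MatrixInverse

variable {n : Type*} [Fintype n] [DecidableEq n]

theorem differentiableAt_det {A : ℂ → Matrix n n ℂ} {x : ℂ}
    (hA : ∀ i j, DifferentiableAt ℂ (fun y => A y i j) x) :
    DifferentiableAt ℂ (fun y => (A y).det) x := by
  simp only [Matrix.det_apply]
  exact DifferentiableAt.fun_sum fun σ _ =>
    (DifferentiableAt.fun_finsetProd fun i _ => hA _ _).const_smul _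

/-- Cramer's rule: the entries are determinants divided by a nonvanishing determinant. -/
theorem differentiableAt_matrix_inv {A : ℂ → Matrix n n ℂ} {x : ℂ}
    (hA : ∀ i j, DifferentiableAt ℂ (fun y => A y i j) x) (hx : IsUnit (A x)) (i j : n) :
    DifferentiableAt ℂ (fun y => (A y)⁻¹ i j) x := by
  simp only [Matrix.inv_def, Matrix.smul_apply, Ring.inverse_eq_inv', smul_eq_mul,
    Matrix.adjugate_apply]
  refine ((differentiableAt_det hA).inv ((Matrix.isUnit_iff_isUnit_det _).1 hx).ne_zero).mul
    (differentiableAt_det fun k l => ?_)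
  simp only [Matrix.updateRow_apply]
  split_ifs
  · exact differentiableAt_const _
  · exact hA k l

end MatrixInverse

/-! ### Calculus of the operator ∂ -/

section Del

variable {f g : ℂ → ℂ} {x : ℂ}

theorem del_congr (h : f =ᶠ[nhds x] g) (v : ℂ) : del f x v = del g x v := by
  rw [del, del, h.fderiv_eq]

theorem del_mul (hf : DifferentiableAt ℝ f x) (hg : DifferentiableAt ℝ g x) (v : ℂ) :
    del (fun y => f y * g y) x v = del f x v * g x + f x * del g x v := by
  simp only [del, fderiv_fun_mul hf hg, add_apply, smul_apply, smul_eq_mul]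
  ring

theorem del_sum {ι : Type*} {s : Finset ι} {f : ι → ℂ → ℂ}
    (hf : ∀ i ∈ s, DifferentiableAt ℝ (f i) x) (v : ℂ) :
    del (fun y => ∑ i ∈ s, f i y) x v = ∑ i ∈ s, del (f i) x v := by
  simp only [del, fderiv_fun_sum hf, sum_apply, Finset.mul_sum, ← Finset.sum_sub_distrib]

theorem fderiv_real_eq (hf : DifferentiableAt ℂ f x) (v : ℂ) :
    fderiv ℝ f x v = deriv f x * v := by
  rw [(hf.hasFDerivAt.restrictScalars ℝ).fderiv]
  change fderiv ℂ f x v = _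
  rw [fderiv_eq_smul_deriv, smul_eq_mul, mul_comm]

theorem del_of_holomorphic (hf : DifferentiableAt ℂ f x) (v : ℂ) :
    del f x v = deriv f x * v := by
  rw [del, fderiv_real_eq hf, fderiv_real_eq hf]
  linear_combination (-1 / 2 * deriv f x * v) * Complex.I_sq

theorem hasFDerivAt_conj (hf : DifferentiableAt ℂ f x) :
    HasFDerivAt (fun y => conj (f y)) ((Complex.conjCLE : ℂ →L[ℝ] ℂ).comp (fderiv ℝ f x)) x :=
  (Complex.conjCLE : ℂ →L[ℝ] ℂ).hasFDerivAt.comp x (hf.restrictScalars ℝ).hasFDerivAt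

theorem del_conj_of_holomorphic (hf : DifferentiableAt ℂ f x) (v : ℂ) :
    del (fun y => conj (f y)) x v = 0 := by
  rw [del, (hasFDerivAt_conj hf).fderiv]
  simp only [ContinuousLinearMap.comp_apply, fderiv_real_eq hf]
  simp
  linear_combination (conj (deriv f x) * conj v) * Complex.I_sq

theorem hasFDerivAt_exp_im_sq (c : ℝ) (x : ℂ) :
    HasFDerivAt (fun y : ℂ => ((Real.exp (c * y.im ^ 2) : ℝ) : ℂ))
      ((Complex.ofRealCLM : ℝ →L[ℝ] ℂ).comp
        ((Real.exp (c * x.im ^ 2) * (c * (2 * x.im))) • Complex.imCLM)) x := by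
  refine (Complex.ofRealCLM : ℝ →L[ℝ] ℂ).hasFDerivAt.comp x ?_
  have h := ((Complex.imCLM.hasFDerivAt (x := x)).pow 2).const_mul c |>.exp
  refine h.congr_fderiv ?_
  ext
  simp
  ring

theorem del_exp_im_sq (c : ℝ) (x v : ℂ) :
    del (fun y : ℂ => ((Real.exp (c * y.im ^ 2) : ℝ) : ℂ)) x v =
      (Real.exp (c * x.im ^ 2) : ℝ) * (-Complex.I * c * x.im * v) := by
  rw [del, (hasFDerivAt_exp_im_sq c x).fderiv]
  simp
  conv_rhs => rw [← Complex.re_add_im v]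
  linear_combination
    (Complex.exp (c * x.im ^ 2) * c * x.im * v.im) * Complex.I_sq

end Del

/-! ### Curvature of a metric exp(c y²) A C A* -/

section Curvature

variable {n : Type*} [Fintype n] [DecidableEq n] {A H : ℂ → Matrix n n ℂ} {C : Matrix n n ℂ}
  {O : Set ℂ} {c : ℝ}

/-- Since C is constant and A* antiholomorphic, ∂ acts only on A and on the scalar, so the
connection form is ∂A · A⁻¹ + ∂(c y²) · 1. -/
theorem chernForm_eq (hO : IsOpen O) (hA : ∀ i j, DifferentiableOn ℂ (fun y => A y i j) O)
    (hAu : ∀ y ∈ O, IsUnit (A y)) (hC : IsUnit C)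
    (hH : ∀ y ∈ O, H y = ((Real.exp (c * y.im ^ 2) : ℝ) : ℂ) • (A y * C * (A y).conjTranspose))
    {x : ℂ} (hx : x ∈ O) (v : ℂ) :
    chernForm H x v = v • (Matrix.of (fun i j => deriv (fun y => A y i j) x) * (A x)⁻¹) +
      (-Complex.I * c * x.im * v) • (1 : Matrix n n ℂ) := by
  have hAx : ∀ i j, DifferentiableAt ℂ (fun y => A y i j) x := fun i j =>
    (hA i j).differentiableAt (hO.mem_nhds hx)
  have hHu : IsUnit (H x).det := by
    rw [← Matrix.isUnit_iff_isUnit_det, hH x hx]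
    have he : IsUnit ((Real.exp (c * x.im ^ 2) : ℝ) : ℂ) :=
      isUnit_iff_ne_zero.2 (by exact_mod_cast (Real.exp_pos _).ne')
    have := ((hAu x hx).mul hC).mul ((Matrix.isUnit_conjTranspose _).2 (hAu x hx))
    rw [Matrix.isUnit_iff_isUnit_det] at this ⊢
    rw [Matrix.det_smul]
    exact (he.pow _).mul this
  have key : Matrix.of (fun i j => del (fun y => H y i j) x v) =
      (v • (Matrix.of (fun i j => deriv (fun y => A y i j) x) * (A x)⁻¹) +
        (-Complex.I * c * x.im * v) • (1 : Matrix n n ℂ)) * H x := by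
    have hmat : (v • (Matrix.of (fun i j => deriv (fun y => A y i j) x) * (A x)⁻¹) +
        (-Complex.I * c * x.im * v) • (1 : Matrix n n ℂ)) * H x =
        ((Real.exp (c * x.im ^ 2) : ℝ) : ℂ) •
          ((v • Matrix.of (fun i j => deriv (fun y => A y i j) x)) *
            (C * (A x).conjTranspose)) +
        (-Complex.I * c * x.im * v) • H x := by
      rw [add_mul, Matrix.smul_mul (-Complex.I * c * x.im * v), one_mul]
      congr 1
      rw [hH x hx, Matrix.mul_smul, Matrix.smul_mul, Matrix.smul_mul, Matrix.mul_assoc,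
        Matrix.mul_assoc (A x), Matrix.nonsing_inv_mul_cancel_left _ _
          ((Matrix.isUnit_iff_isUnit_det _).1 (hAu x hx))]
    rw [hmat]
    ext i j
    have hE := hasFDerivAt_exp_im_sq c x
    have hN : ∀ k, DifferentiableAt ℝ (fun y => (C * (A y).conjTranspose) k j) x := fun k => by
      simp only [Matrix.mul_apply, Matrix.conjTranspose_apply, RCLike.star_def]
      exact DifferentiableAt.fun_sum fun l _ =>
        (hasFDerivAt_conj (hAx j l)).differentiableAt.const_mul _
    have hN0 : ∀ k, del (fun y => (C * (A y).conjTranspose) k j) x v = 0 := fun k => by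
      simp only [Matrix.mul_apply, Matrix.conjTranspose_apply, RCLike.star_def]
      rw [del_sum fun l _ => (hasFDerivAt_conj (hAx j l)).differentiableAt.const_mul _]
      refine Finset.sum_eq_zero fun l _ => ?_
      rw [del_mul (differentiableAt_const _) (hasFDerivAt_conj (hAx j l)).differentiableAt,
        del_conj_of_holomorphic (hAx j l)]
      simp [del]
    have hHij : (fun y => H y i j) =ᶠ[nhds x] fun y =>
        ((Real.exp (c * y.im ^ 2) : ℝ) : ℂ) *
          ∑ k, A y i k * (C * (A y).conjTranspose) k j := by
      filter_upwards [hO.mem_nhds hx] with y hy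
      rw [hH y hy, Matrix.mul_assoc, Matrix.smul_apply, smul_eq_mul, Matrix.mul_apply]
    rw [Matrix.of_apply, del_congr hHij, del_mul hE.differentiableAt
      (DifferentiableAt.fun_sum fun k _ => ((hAx i k).restrictScalars ℝ).fun_mul (hN k)),
      del_sum (fun k _ => ((hAx i k).restrictScalars ℝ).fun_mul (hN k)), del_exp_im_sq,
      Matrix.add_apply, Matrix.smul_apply, Matrix.smul_apply,
      show H x i j = _ from hHij.self_of_nhds, add_comm]
    congr 1
    · rw [Matrix.mul_apply, smul_eq_mul]
      congr 1
      refine Finset.sum_congr rfl fun k _ => ?_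
      rw [del_mul ((hAx i k).restrictScalars ℝ) (hN k), hN0, del_of_holomorphic (hAx i k)]
      simp [mul_comm]
    · rw [smul_eq_mul]; ring
  rw [chernForm, key, Matrix.mul_nonsing_inv_cancel_right _ _ hHu]

/-- In one variable the part ∂A · A⁻¹ is a holomorphic matrix times dw, hence closed, and θ ∧ θ = 0
because dw ∧ dw = 0. Only d(-i c y dw) = -(c/2) dw ∧ dw̄ survives. -/
theorem chernCurvature_eq (hO : IsOpen O) (hA : ∀ i j, DifferentiableOn ℂ (fun y => A y i j) O)
    (hAu : ∀ y ∈ O, IsUnit (A y)) (hC : IsUnit C)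
    (hH : ∀ y ∈ O, H y = ((Real.exp (c * y.im ^ 2) : ℝ) : ℂ) • (A y * C * (A y).conjTranspose))
    {x : ℂ} (hx : x ∈ O) (u v : ℂ) :
    chernCurvature H x u v = (-(c / 2 : ℝ) * dwdwbar u v) • (1 : Matrix n n ℂ) := by
  set B : ℂ → Matrix n n ℂ := fun x =>
    Matrix.of (fun i j => deriv (fun y => A y i j) x) * (A x)⁻¹ with hB
  have hform : ∀ y ∈ O, ∀ v, chernForm H y v =
      v • B y + (-Complex.I * c * y.im * v) • (1 : Matrix n n ℂ) := fun y hy v =>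
    chernForm_eq hO hA hAu hC hH hy v
  have hBx : ∀ i j, DifferentiableAt ℂ (fun y => B y i j) x := fun i j => by
    simp only [hB, Matrix.mul_apply, Matrix.of_apply]
    exact DifferentiableAt.fun_sum fun k _ =>
      (((hA i k).deriv hO).differentiableAt (hO.mem_nhds hx)).mul
        (differentiableAt_matrix_inv (fun i j => (hA i j).differentiableAt (hO.mem_nhds hx))
          (hAu x hx) k j)
  have hd : ∀ u v i j, fderiv ℝ (fun y => chernForm H y v i j) x u =
      v * (deriv (fun y => B y i j) x * u) +
        (-Complex.I * c * u.im * v) * (1 : Matrix n n ℂ) i j := fun u v i j => by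
    have he : (fun y => chernForm H y v i j) =ᶠ[nhds x] fun y =>
        v * B y i j + (y.im : ℂ) * (-Complex.I * c * v * (1 : Matrix n n ℂ) i j) := by
      filter_upwards [hO.mem_nhds hx] with y hy
      rw [hform y hy, Matrix.add_apply, Matrix.smul_apply, Matrix.smul_apply, smul_eq_mul,
        smul_eq_mul]
      ring
    have him : HasFDerivAt (fun y : ℂ => (y.im : ℂ)) (Complex.ofRealCLM.comp Complex.imCLM) x :=
      (Complex.ofRealCLM.comp Complex.imCLM).hasFDerivAt
    rw [he.fderiv_eq, ((((hBx i j).restrictScalars ℝ).hasFDerivAt.const_mul v).fun_add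
      (him.mul_const _)).fderiv]
    simp only [add_apply, smul_apply, fderiv_real_eq (hBx i j), smul_eq_mul,
      ContinuousLinearMap.comp_apply, Complex.ofRealCLM_apply, Complex.imCLM_apply]
    ring
  have hcomm : chernForm H x u * chernForm H x v - chernForm H x v * chernForm H x u = 0 := by
    rw [hform x hx, hform x hx]
    simp only [add_mul, mul_add, Matrix.smul_mul, Matrix.mul_smul, one_mul, mul_one, smul_smul]
    module
  rw [chernCurvature, hcomm, sub_zero]
  ext i j
  rw [Matrix.of_apply, hd, hd, Matrix.smul_apply, smul_eq_mul, dwdwbar]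
  have hc : ∀ w : ℂ, conj w = w - 2 * w.im * Complex.I := fun w => by
    apply Complex.ext <;> simp; ring
  rw [hc, hc]
  push_cast
  ring

end Curvature

/-! ### Holomorphic dependence of the theta coefficients -/

section Coefficients

variable (δ : ℕ) [NeZero δ] (τ : ℍ)

/-- The coordinate of a section of `L₀` along the `j`-th theta function, as a finite linear
combination of point evaluations. -/
noncomputable def thetaCoeff (j : Fin δ) (F : ℂ → ℂ) : ℂ :=
  (exists_evaluation_coeff (linearIndependent_theta δ τ) j).choose.sum fun x a => a * F x

variable {δ τ}

theorem eq_sum_thetaCoeff {F : ℂ → ℂ} (hF : F ∈ (L0 δ τ).H0) (y : ℂ) :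
    F y = ∑ j, thetaCoeff δ τ j F * theta δ τ j y := by
  rw [← span_theta, Submodule.mem_span_range_iff_exists_fun] at hF
  obtain ⟨b, rfl⟩ := hF
  have hb : ∀ j, thetaCoeff δ τ j (∑ i, b i • theta δ τ i) = b j := by
    intro j
    have h := (exists_evaluation_coeff (linearIndependent_theta δ τ) j).choose_spec
    simp only [Finsupp.sum] at h
    simp only [thetaCoeff, Finsupp.sum, Finset.sum_apply, Pi.smul_apply, smul_eq_mul,
      Finset.mul_sum]
    rw [Finset.sum_comm]
    simp only [mul_left_comm _ (b _), ← Finset.mul_sum, h]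
    simp
  simp [hb]

/-- Writing a coefficient as finitely many point evaluations makes holomorphy in μ immediate; no
integral has to be differentiated. -/
theorem differentiableOn_thetaCoeff {S : ℂ × ℂ → ℂ} {O : Set ℂ}
    (hS : DifferentiableOn ℂ S (Set.univ ×ˢ O)) (j : Fin δ) :
    DifferentiableOn ℂ (fun μ => thetaCoeff δ τ j fun y => S (y - μ, μ)) O := by
  simp only [thetaCoeff, Finsupp.sum]
  refine DifferentiableOn.fun_sum fun x _ => DifferentiableOn.const_mul ?_ _
  exact hS.comp (f := fun μ => (x - μ, μ)) (by fun_prop) fun μ hμ => ⟨trivial, hμ⟩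

end Coefficients

/-! ### The fibres of E and the coefficient matrix of a frame -/

section Fibres

variable {δ : ℕ} {τ : ℍ} {P : HolLineBundle (prodPeriod δ τ)} {g : ℂ × ℂ → ℂ}

/-- `g` is an isomorphism from `P` to the standard Poincaré bundle. -/
structure IsComparison [NeZero δ] (P : HolLineBundle (prodPeriod δ τ)) (g : ℂ × ℂ → ℂ) : Prop where
  differentiable : Differentiable ℂ g
  ne_zero : ∀ w, g w ≠ 0
  equivariant : ∀ γ w, g (w + prodPeriod δ τ γ) * P.mult γ w = (stdPoincare δ τ).mult γ w * g w

theorem IsComparison.equivariant_fibre [NeZero δ] (hg : IsComparison P g) (a : ℤ × ℤ) (z μ : ℂ) :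
    g (z + period δ τ a, μ) * P.mult (a, 0) (z, μ) =
      Complex.exp (-2 * Real.pi * Complex.I * (a.2 * μ)) * g (z, μ) := by
  simpa [prodPeriod, AddMonoidHom.prodMap_def, stdPoincare] using hg.equivariant (a, 0) (z, μ)

theorem restrictM_ETilde_mult (a : ℤ × ℤ) (z μ : ℂ) :
    (restrictM (ETilde P) μ).mult a z = (L0 δ τ).mult a z * P.mult (a, 0) (z, μ) := rfl

/-- Translation by μ twists L₀ by the very character that `stdPoincare` has on M × {μ}; this is why
translation undoes the twist. -/
theorem L0_mult_add (a : ℤ × ℤ) (z μ : ℂ) :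
    (L0 δ τ).mult a (z + μ) =
      Complex.exp (-2 * Real.pi * Complex.I * (a.2 * μ)) * (L0 δ τ).mult a z := by
  simp only [L0]
  rw [← Complex.exp_add]
  congr 1
  ring

/-- Multiplication by `g` and translation by `μ` identify the fibre of `E` with `H⁰(M, L₀)`. -/
noncomputable def fibreEquiv [NeZero δ] (hg : IsComparison P g) (μ : ℂ) :
    EFibre P μ ≃ₗ[ℂ] (L0 δ τ).H0 where
  toFun f := ⟨fun y => g (y - μ, μ) * f.1 (y - μ), by
    have h1 := hg.differentiable
    have h2 := f.2.1
    refine ⟨by fun_prop, fun a y => ?_⟩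
    have h3 := hg.equivariant_fibre a (y - μ) μ
    have h4 := L0_mult_add (τ := τ) (δ := δ) a (y - μ) μ
    rw [sub_add_cancel] at h4
    simp only
    rw [add_sub_right_comm, f.2.2, restrictM_ETilde_mult, h4]
    linear_combination ((L0 δ τ).mult a (y - μ) * f.1 (y - μ)) * h3⟩
  invFun F := ⟨fun z => F.1 (z + μ) / g (z, μ), by
    have h1 := hg.differentiable
    have h2 := F.2.1
    have h0 := hg.ne_zero
    refine ⟨by fun_prop (disch := exact fun _ => h0 _), fun a z => ?_⟩
    have h3 := hg.equivariant_fibre a z μ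
    simp only
    rw [add_right_comm, F.2.2, L0_mult_add, restrictM_ETilde_mult, mul_div_assoc',
      div_eq_div_iff (h0 _) (h0 _)]
    linear_combination (-(L0 δ τ).mult a z * F.1 (z + μ)) * h3⟩
  map_add' f f' := by ext y; simp [mul_add]
  map_smul' c f := by ext y; simp [mul_left_comm]
  left_inv f := by ext y; simp [hg.ne_zero]
  right_inv F := by ext y; simp [mul_div_cancel₀, hg.ne_zero]

theorem finrank_EFibre [NeZero δ] (hg : IsComparison P g) (μ : ℂ) :
    Module.finrank ℂ (EFibre P μ) = δ := by
  rw [(fibreEquiv hg μ).finrank_eq, finrank_H0]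

theorem fibreEquiv_apply [NeZero δ] (hg : IsComparison P g) (μ : ℂ) (f : EFibre P μ) (y : ℂ) :
    (fibreEquiv hg μ f).1 y = g (y - μ, μ) * f.1 (y - μ) := rfl

theorem IsESection.mem_EFibre {U : Set (MHat δ τ)} {s : ℂ × ℂ → ℂ} (hs : IsESection P U s)
    {μ : ℂ} (hμ : μ ∈ lift U) : (fun z => s (z, μ)) ∈ EFibre P μ := by
  refine ⟨fun z => ?_, fun a z => ?_⟩
  · have h : DifferentiableOn ℂ (fun z => s (z, μ)) Set.univ :=
      hs.1.comp (f := fun z => (z, μ)) (by fun_prop) fun z _ => ⟨trivial, hμ⟩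
    exact h.differentiableAt Filter.univ_mem
  · have h := hs.2 (a, 0) (z, μ) ⟨trivial, hμ⟩
    simpa [prodPeriod, AddMonoidHom.prodMap_def, restrictM, HolLineBundle.pullback] using h

/-- The matrix of the members of a family of sections in terms of the theta functions. -/
noncomputable def thetaMatrix [NeZero δ] (τ : ℍ) (g : ℂ × ℂ → ℂ) (s : Fin δ → ℂ × ℂ → ℂ) (μ : ℂ) :
    Matrix (Fin δ) (Fin δ) ℂ :=
  Matrix.of fun i j => thetaCoeff δ τ j fun y => g (y - μ, μ) * s i (y - μ, μ)

theorem IsESection.expand [NeZero δ] (hg : IsComparison P g) {U : Set (MHat δ τ)} {s : ℂ × ℂ → ℂ}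
    (hs : IsESection P U s) {μ : ℂ} (hμ : μ ∈ lift U) (y : ℂ) :
    g (y - μ, μ) * s (y - μ, μ) =
      ∑ j, thetaCoeff δ τ j (fun y => g (y - μ, μ) * s (y - μ, μ)) * theta δ τ j y :=
  eq_sum_thetaCoeff (fibreEquiv hg μ ⟨_, hs.mem_EFibre hμ⟩).2 y

theorem IsESection.differentiableOn_thetaCoeff [NeZero δ] (hg : IsComparison P g) {U : Set (MHat δ τ)}
    {s : ℂ × ℂ → ℂ} (hs : IsESection P U s) (j : Fin δ) :
    DifferentiableOn ℂ (fun μ => thetaCoeff δ τ j fun y => g (y - μ, μ) * s (y - μ, μ))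
      (lift U) :=
  AdiabaticTorus.differentiableOn_thetaCoeff (hg.differentiable.differentiableOn.mul hs.1) j

/-- A relation among the rows becomes, after division by g, a relation among the members of the
frame. -/
theorem IsEFrame.isUnit_thetaMatrix [NeZero δ] (hg : IsComparison P g) {U : Set (MHat δ τ)}
    {s : Fin δ → ℂ × ℂ → ℂ} (hs : IsEFrame P U s) {μ : ℂ} (hμ : μ ∈ lift U) :
    IsUnit (thetaMatrix τ g s μ) := by
  rw [← Matrix.linearIndependent_rows_iff_isUnit, Fintype.linearIndependent_iff]
  intro v hv
  refine Fintype.linearIndependent_iff.1 (hs.linearIndependent μ hμ) v ?_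
  ext z
  have h : ∀ i, g (z, μ) * s i (z, μ) = ∑ j, thetaMatrix τ g s μ i j * theta δ τ j (z + μ) :=
    fun i => by simpa [thetaMatrix] using (hs.isSection i).expand hg hμ (z + μ)
  simp only [Finset.sum_apply, Pi.smul_apply, smul_eq_mul, Pi.zero_apply]
  apply mul_left_cancel₀ (hg.ne_zero (z, μ))
  rw [mul_zero, Finset.mul_sum]
  simp only [mul_left_comm (g (z, μ)), h, Finset.mul_sum]
  rw [Finset.sum_comm]
  refine Finset.sum_eq_zero fun j _ => ?_
  have hj := congrFun hv j
  simp only [Finset.sum_apply, Pi.smul_apply, smul_eq_mul, Pi.zero_apply, Matrix.row] at hj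
  simp only [← mul_assoc, ← Finset.sum_mul, hj, zero_mul]

theorem isOpen_lift {U : Set (MHat δ τ)} (hU : IsOpen U) : IsOpen (lift U) :=
  hU.preimage QuotientAddGroup.continuous_mk

/-- With b the row of theta coefficients of t and A the matrix of the frame, the coefficients are b
A⁻¹, holomorphic since b and A are. -/
theorem IsEFrame.exists_coeff [NeZero δ] (hg : IsComparison P g) {U : Set (MHat δ τ)} (hU : IsOpen U)
    {s : Fin δ → ℂ × ℂ → ℂ} (hs : IsEFrame P U s) {t : ℂ × ℂ → ℂ} (ht : IsESection P U t) :
    ∃ c : Fin δ → ℂ → ℂ, (∀ i, DifferentiableOn ℂ (c i) (lift U)) ∧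
      ∀ μ ∈ lift U, ∀ z, t (z, μ) = ∑ i, c i μ * s i (z, μ) := by
  refine ⟨fun i μ => ∑ j, thetaCoeff δ τ j (fun y => g (y - μ, μ) * t (y - μ, μ)) *
    (thetaMatrix τ g s μ)⁻¹ j i, fun i => ?_, fun μ hμ z => ?_⟩
  · refine DifferentiableOn.fun_sum fun j _ =>
      (ht.differentiableOn_thetaCoeff hg j).mul fun μ hμ => ?_
    refine (differentiableAt_matrix_inv (fun k l => ?_)
      (hs.isUnit_thetaMatrix hg hμ) j i).differentiableWithinAt
    exact ((hs.isSection k).differentiableOn_thetaCoeff hg l).differentiableAt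
      ((isOpen_lift hU).mem_nhds hμ)
  · have hu := (Matrix.isUnit_iff_isUnit_det _).1 (hs.isUnit_thetaMatrix hg hμ)
    have h : ∀ i, g (z, μ) * s i (z, μ) =
        ∑ j, thetaMatrix τ g s μ i j * theta δ τ j (z + μ) :=
      fun i => by simpa [thetaMatrix] using (hs.isSection i).expand hg hμ (z + μ)
    have h' : g (z, μ) * t (z, μ) =
        ∑ j, thetaCoeff δ τ j (fun y => g (y - μ, μ) * t (y - μ, μ)) * theta δ τ j (z + μ) := by
      simpa using ht.expand hg hμ (z + μ)
    apply mul_left_cancel₀ (hg.ne_zero (z, μ))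
    rw [h', Finset.mul_sum]
    simp only [mul_left_comm (g (z, μ)), h]
    set b : Fin δ → ℂ := fun j => thetaCoeff δ τ j (fun y => g (y - μ, μ) * t (y - μ, μ))
    set A := thetaMatrix τ g s μ
    set θ : Fin δ → ℂ := fun j => theta δ τ j (z + μ)
    change b ⬝ᵥ θ = Matrix.vecMul b A⁻¹ ⬝ᵥ Matrix.mulVec A θ
    rw [← Matrix.dotProduct_mulVec, Matrix.mulVec_mulVec, Matrix.nonsing_inv_mul _ hu,
      Matrix.one_mulVec]

end Fibres

/-! ### Existence of local holomorphic frames -/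

section LocalFrames

variable {δ : ℕ} [NeZero δ] {τ : ℍ} {P : HolLineBundle (prodPeriod δ τ)} {g : ℂ × ℂ → ℂ}

variable (δ τ) in
theorem exists_dualPeriod_norm_bound :
    ∃ r : ℝ, 0 < r ∧ ∀ m : ℤ × ℤ, ‖dualPeriod δ τ m‖ < r → m = 0 := by
  have hδ : (0 : ℝ) < δ := by exact_mod_cast Nat.pos_of_neZero δ
  have him : ∀ m, (dualPeriod δ τ m).im = m.2 * (τ.im / δ) := fun m => by
    simp [dualPeriod]
  have hp : 0 < τ.im / δ := div_pos τ.im_pos hδ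
  refine ⟨min 1 (τ.im / δ), lt_min one_pos hp, fun m hm => ?_⟩
  obtain ⟨h1, h2⟩ := lt_min_iff.1 hm
  have hm2 : m.2 = 0 := by
    have h3 := (Complex.abs_im_le_norm (dualPeriod δ τ m)).trans_lt h2
    rw [him, abs_mul, abs_of_pos hp] at h3
    have h4 : |(m.2 : ℝ)| < 1 := by
      by_contra! hge
      nlinarith
    exact Int.abs_lt_one_iff.1 (by exact_mod_cast h4)
  have hm1 : m.1 = 0 := by
    rw [show dualPeriod δ τ m = (m.1 : ℂ) by simp [dualPeriod, hm2], Complex.norm_intCast] at h1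
    exact Int.abs_lt_one_iff.1 (by exact_mod_cast h1)
  exact Prod.ext hm1 hm2

/-- The functions θⱼ(z + μ)/g trivialise E over a ball of μ. When the lattice translates of the ball
are disjoint, the multipliers of Ẽ extend them equivariantly to the whole preimage. -/
theorem exists_frame (hg : IsComparison P g) (x : MHat δ τ) :
    ∃ U : Set (MHat δ τ), IsOpen U ∧ x ∈ U ∧ ∃ s : Fin δ → ℂ × ℂ → ℂ, IsEFrame P U s := by
  obtain ⟨r, hr, hmin⟩ := exists_dualPeriod_norm_bound δ τ
  obtain ⟨μ₀, rfl⟩ := QuotientAddGroup.mk_surjective x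
  -- Radius r/2 makes two points of the ball differ by less than r, so by no nonzero period.
  set B := Metric.ball μ₀ (r / 2) with hB
  set U : Set (MHat δ τ) := (fun μ : ℂ => (μ : MHat δ τ)) '' B with hU
  have hlift : ∀ μ, μ ∈ lift U ↔ ∃ m, μ - dualPeriod δ τ m ∈ B := by
    intro μ
    constructor
    · rintro ⟨ν, hν, hνμ⟩
      obtain ⟨m, hm⟩ := (QuotientAddGroup.eq (s := (dualPeriod δ τ).range)).1 hνμ
      refine ⟨m, ?_⟩
      rw [hm]
      convert hν using 1
      ring
    · rintro ⟨m, hm⟩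
      refine ⟨_, hm, ?_⟩
      exact (QuotientAddGroup.eq (s := (dualPeriod δ τ).range)).2 ⟨m, by ring⟩
  have huniq : ∀ μ m m', μ - dualPeriod δ τ m ∈ B → μ - dualPeriod δ τ m' ∈ B → m = m' := by
    intro μ m m' h h'
    refine sub_eq_zero.1 (hmin _ ?_)
    rw [map_sub]
    have := dist_triangle_right (μ - dualPeriod δ τ m') (μ - dualPeriod δ τ m) μ₀
    rw [dist_eq_norm, sub_sub_sub_cancel_left] at this
    rw [hB, Metric.mem_ball] at h h'
    linarith
  -- k μ is the unique period index bringing μ back into the ball; it is therefore locally constant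
  -- and equivariant.
  choose! k hk using fun μ => (hlift μ).1
  set f : Fin δ → ℂ × ℂ → ℂ := fun j w => theta δ τ j (w.1 + w.2) / g w with hf
  have hfd : ∀ j, Differentiable ℂ (f j) := fun j => by
    have h1 := hg.differentiable
    have h2 := differentiable_theta δ τ j
    have h0 := hg.ne_zero
    have h3 : Differentiable ℂ fun w : ℂ × ℂ => theta δ τ j (w.1 + w.2) := h2.comp (by fun_prop)
    simp only [hf, div_eq_mul_inv]
    exact h3.mul fun w => (hasDerivAt_inv (h0 w)).differentiableAt.comp w (h1 w)
  have hfM : ∀ j a z μ, f j (z + period δ τ a, μ) =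
      (ETilde P).mult (a, 0) (z, μ) * f j (z, μ) := fun j a z μ =>
    ((fibreEquiv hg μ).symm ⟨_, theta_mem_H0 δ τ j⟩).2.2 a z
  have hsec : ∀ j, IsESection P U (fun w => (ETilde P).mult (0, k w.2)
      (w.1, w.2 - dualPeriod δ τ (k w.2)) * f j (w.1, w.2 - dualPeriod δ τ (k w.2))) := by
    intro j
    refine ⟨?_, ?_⟩
    · rintro ⟨z, μ⟩ ⟨-, hμ⟩
      have hnear : ∀ᶠ w : ℂ × ℂ in nhds (z, μ), k w.2 = k μ := by
        have hO : IsOpen {w : ℂ × ℂ | w.2 - dualPeriod δ τ (k μ) ∈ B} :=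
          Metric.isOpen_ball.preimage (by fun_prop)
        filter_upwards [hO.mem_nhds (hk μ hμ)] with w hw
        exact huniq w.2 _ _ (hk w.2 ((hlift _).2 ⟨_, hw⟩)) hw
      have hd : DifferentiableAt ℂ (fun w : ℂ × ℂ => (ETilde P).mult (0, k μ)
          (w.1, w.2 - dualPeriod δ τ (k μ)) * f j (w.1, w.2 - dualPeriod δ τ (k μ))) (z, μ) := by
        have h1 := (ETilde P).holo (0, k μ)
        have h2 := hfd j
        have h3 : Differentiable ℂ fun w : ℂ × ℂ => (w.1, w.2 - dualPeriod δ τ (k μ)) := by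
          fun_prop
        exact ((h1.comp h3).mul (h2.comp h3)) _
      refine (hd.congr_of_eventuallyEq ?_).differentiableWithinAt
      filter_upwards [hnear] with w hw
      rw [hw]
    · rintro ⟨a, m⟩ ⟨z, μ⟩ ⟨-, hμ⟩
      have hkm : k (μ + dualPeriod δ τ m) = k μ + m := by
        have h1 : μ + dualPeriod δ τ m - dualPeriod δ τ (k μ + m) ∈ B := by
          rw [map_add, add_sub_add_right_eq_sub]
          exact hk μ hμ
        exact huniq _ _ _ (hk _ ((hlift _).2 ⟨_, h1⟩)) h1
      have e : ((z, μ) : ℂ × ℂ) + prodPeriod δ τ (a, m) =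
          (z + period δ τ a, μ + dualPeriod δ τ m) := rfl
      rw [e]
      simp only
      rw [hkm]
      set ν := μ - dualPeriod δ τ (k μ) with hν
      have e2 : μ + dualPeriod δ τ m - dualPeriod δ τ (k μ + m) = ν := by
        rw [map_add, hν]; ring
      rw [e2, hfM]
      -- Equivariance compares two factorisations of the multiplier of (a, k μ + m).
      have c1 := (ETilde P).cocycle (0, k μ + m) (a, 0) (z, ν)
      have c2 := (ETilde P).cocycle (a, m) (0, k μ) (z, ν)
      have e3 : ((z, ν) : ℂ × ℂ) + prodPeriod δ τ (a, 0) = (z + period δ τ a, ν) := by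
        simp [prodPeriod, AddMonoidHom.prodMap_def]
      have e4 : ((z, ν) : ℂ × ℂ) + prodPeriod δ τ (0, k μ) = (z, μ) := by
        simp [prodPeriod, AddMonoidHom.prodMap_def, hν]
      have e5 : ((0, k μ + m) : (ℤ × ℤ) × (ℤ × ℤ)) + (a, 0) = (a, m) + (0, k μ) := by
        simp [add_comm]
      rw [e3, e5, c2, e4] at c1
      rw [← mul_assoc, ← mul_assoc, c1]
  have hli : ∀ μ ∈ lift U, LinearIndependent ℂ (fun j z => (ETilde P).mult (0, k μ)
      (z, μ - dualPeriod δ τ (k μ)) * f j (z, μ - dualPeriod δ τ (k μ))) := by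
    intro μ _
    rw [Fintype.linearIndependent_iff]
    intro c hc
    refine Fintype.linearIndependent_iff.1 (linearIndependent_theta δ τ) c ?_
    ext y
    have h := congrFun hc (y - (μ - dualPeriod δ τ (k μ)))
    simp only [hf, Finset.sum_apply, Pi.smul_apply, smul_eq_mul, Pi.zero_apply,
      sub_add_cancel] at h ⊢
    set w : ℂ × ℂ := (y - (μ - dualPeriod δ τ (k μ)), μ - dualPeriod δ τ (k μ))
    apply mul_left_cancel₀ (div_ne_zero ((ETilde P).ne_zero (0, k μ) w) (hg.ne_zero w))
    rw [mul_zero, ← h, Finset.mul_sum]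
    refine Finset.sum_congr rfl fun j _ => ?_
    ring
  refine ⟨U, ?_, ⟨μ₀, Metric.mem_ball_self (by positivity), rfl⟩, _, hsec, hli, ?_⟩
  · exact QuotientAddGroup.isOpenMap_coe _ Metric.isOpen_ball
  · intro μ hμ
    have : FiniteDimensional ℂ (EFibre P μ) := Module.Finite.equiv (fibreEquiv hg μ).symm
    apply Submodule.eq_of_le_of_finrank_eq
    · rw [Submodule.span_le]
      rintro _ ⟨j, rfl⟩
      exact (hsec j).mem_EFibre hμ
    · rw [finrank_EFibre hg, finrank_span_eq_card (hli μ hμ), Fintype.card_fin]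

end LocalFrames

/-! ### The L²-metric in a frame, and the theorem -/

section Gram

theorem chernOne_eq {δ : ℕ} {τ : ℍ} {H : ℂ → Matrix (Fin δ) (Fin δ) ℂ} {x u v : ℂ}
    (h : chernCurvature H x u v = (-((Real.pi / τ.im : ℝ) : ℂ) * dwdwbar u v) •
      (1 : Matrix (Fin δ) (Fin δ) ℂ)) :
    chernOne H x u v = -(Complex.I * δ / (2 * τ.im)) * dwdwbar u v := by
  have hπ : (Real.pi : ℂ) ≠ 0 := by exact_mod_cast Real.pi_ne_zero
  have hτ : (τ.im : ℂ) ≠ 0 := by exact_mod_cast τ.im_pos.ne'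
  rw [chernOne, h, Matrix.trace_smul, Matrix.trace_one, Fintype.card_fin, smul_eq_mul]
  push_cast
  field_simp

variable {δ : ℕ} [NeZero δ] {τ : ℍ} {P : HolLineBundle (prodPeriod δ τ)} {g Φ : ℂ × ℂ → ℂ}

/-- Completing the square: -z₂² - 2μ₂z₂ = μ₂² - (z₂ + μ₂)², where the cross term comes from the norm
of `stdIdentification`. -/
theorem hETilde_eq (hΦ : ∀ w, Φ w = g w * stdIdentification τ w) (z μ : ℂ) :
    hETilde δ τ Φ (z, μ) =
      Real.exp (2 * Real.pi / τ.im * μ.im ^ 2) * (hL0 τ (z + μ) * ‖g (z, μ)‖ ^ 2) := by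
  have hτ : τ.im ≠ 0 := τ.im_pos.ne'
  have h : ‖stdIdentification τ (z, μ)‖ = Real.exp (-(2 * Real.pi / τ.im * μ.im * z.im)) := by
    rw [stdIdentification, Complex.norm_exp]
    congr 1
    simp
    ring
  have h2 : hL0 τ z * ‖stdIdentification τ (z, μ)‖ ^ 2 =
      Real.exp (2 * Real.pi / τ.im * μ.im ^ 2) * hL0 τ (z + μ) := by
    rw [h, hL0, hL0, ← Real.exp_nat_mul, ← Real.exp_add, ← Real.exp_add]
    congr 1
    simp
    ring
  rw [hETilde, GaugeLineBundle.pullbackMetric, gaugePullback_metric, hΦ, norm_mul]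
  linear_combination ‖g (z, μ)‖ ^ 2 * h2

/-- The weight at z + μ becomes the weight of L₀ by translation invariance of the integral, so all
dependence of the metric on μ sits in the scalar. -/
theorem hE_eq (hg : IsComparison P g) (hΦ : ∀ w, Φ w = g w * stdIdentification τ w) {μ : ℂ}
    (f f' : EFibre P μ) :
    hE δ τ Φ μ f f' = (Real.exp (2 * Real.pi / τ.im * μ.im ^ 2) : ℝ) *
      innerL0 δ τ (fibreEquiv hg μ f) (fibreEquiv hg μ f') := by
  rw [innerL0, ← setIntegral_parallelogram_translate (fun a z => hL0_mul_mul_conj_periodic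
    (fibreEquiv hg μ f).2 (fibreEquiv hg μ f').2 a z) μ, hE, ← integral_const_mul]
  congr 1
  ext z
  simp only [fibreEquiv_apply, add_sub_cancel_right, map_mul, hETilde_eq hΦ]
  push_cast
  rw [← Complex.mul_conj']
  ring

theorem gram_eq (hg : IsComparison P g) (hΦ : ∀ w, Φ w = g w * stdIdentification τ w)
    {U : Set (MHat δ τ)} {s : Fin δ → ℂ × ℂ → ℂ} (hs : ∀ i, IsESection P U (s i)) {μ : ℂ}
    (hμ : μ ∈ lift U) :
    gram δ τ Φ s μ = ((Real.exp (2 * Real.pi / τ.im * μ.im ^ 2) : ℝ) : ℂ) •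
      (thetaMatrix τ g s μ * thetaGram δ τ * (thetaMatrix τ g s μ).conjTranspose) := by
  ext i j
  have he : ∀ i, ((fibreEquiv hg μ ⟨_, (hs i).mem_EFibre hμ⟩ : (L0 δ τ).H0) : ℂ → ℂ) =
      fun y => ∑ k, thetaMatrix τ g s μ i k * theta δ τ k y :=
    fun i => funext fun y => (hs i).expand hg hμ y
  have h := hE_eq hg hΦ ⟨_, (hs i).mem_EFibre hμ⟩ ⟨_, (hs j).mem_EFibre hμ⟩
  rw [he, he, innerL0_sum (theta_mem_H0 δ τ)] at h
  rw [gram, Matrix.of_apply, h, Matrix.smul_apply, smul_eq_mul]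
  congr 1
  simp only [Matrix.mul_apply, Finset.sum_mul, Matrix.conjTranspose_apply, thetaGram,
    Matrix.of_apply, RCLike.star_def]
  rw [Finset.sum_comm]
  exact Finset.sum_congr rfl fun k _ => Finset.sum_congr rfl fun l _ => by ring

theorem posDef_gram (hg : IsComparison P g) (hΦ : ∀ w, Φ w = g w * stdIdentification τ w)
    {U : Set (MHat δ τ)} {s : Fin δ → ℂ × ℂ → ℂ} (hs : IsEFrame P U s) {μ : ℂ}
    (hμ : μ ∈ lift U) : (gram δ τ Φ s μ).PosDef := by
  rw [gram_eq hg hΦ hs.isSection hμ]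
  refine Matrix.PosDef.smul ?_ (by exact_mod_cast Real.exp_pos _)
  exact (posDef_thetaGram δ τ).mul_mul_conjTranspose_same
    (Matrix.vecMul_injective_iff_isUnit.2 (hs.isUnit_thetaMatrix hg hμ))

theorem contDiffOn_gram (hg : IsComparison P g) (hΦ : ∀ w, Φ w = g w * stdIdentification τ w)
    {U : Set (MHat δ τ)} (hU : IsOpen U) {s : Fin δ → ℂ × ℂ → ℂ}
    (hs : ∀ i, IsESection P U (s i)) (i j : Fin δ) :
    ContDiffOn ℝ ∞ (fun μ => gram δ τ Φ s μ i j) (lift U) := by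
  have hA : ∀ i k, ContDiffOn ℝ ∞ (fun μ => thetaMatrix τ g s μ i k) (lift U) := fun i k =>
    (((hs i).differentiableOn_thetaCoeff hg k).contDiffOn (isOpen_lift hU)).restrict_scalars ℝ
  have hA' : ∀ i k, ContDiffOn ℝ ∞ (fun μ => conj (thetaMatrix τ g s μ i k)) (lift U) :=
    fun i k => (Complex.conjCLE : ℂ →L[ℝ] ℂ).contDiff.comp_contDiffOn (hA i k)
  have he : ContDiff ℝ ∞ fun μ : ℂ => ((Real.exp (2 * Real.pi / τ.im * μ.im ^ 2) : ℝ) : ℂ) :=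
    Complex.ofRealCLM.contDiff.comp
      (contDiff_const.mul (Complex.imCLM.contDiff.pow 2)).exp
  have h : ContDiffOn ℝ ∞ (fun μ => ((Real.exp (2 * Real.pi / τ.im * μ.im ^ 2) : ℝ) : ℂ) *
      ∑ l, (∑ k, thetaMatrix τ g s μ i k * thetaGram δ τ k l) *
        conj (thetaMatrix τ g s μ j l)) (lift U) :=
    he.contDiffOn.mul (ContDiffOn.sum fun l _ =>
      (ContDiffOn.sum fun k _ => (hA i k).mul contDiffOn_const).mul (hA' j l))
  refine h.congr fun μ hμ => ?_
  rw [gram_eq hg hΦ hs hμ]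
  simp only [Matrix.smul_apply, smul_eq_mul, Matrix.mul_apply, Matrix.conjTranspose_apply,
    RCLike.star_def]

/-- The `L²`-metric is compatible with the identification of the fibres of `E` over the lifts of
a point. -/
theorem gram_add_dualPeriod
    (hΦ : GaugeLineBundle.IsIdentification P (gaugePullback δ τ) Φ)
    {U : Set (MHat δ τ)} {n : ℕ} {s : Fin n → ℂ × ℂ → ℂ} (hs : ∀ i, IsESection P U (s i)) {μ : ℂ}
    (hμ : μ ∈ lift U) (m : ℤ × ℤ) : gram δ τ Φ s (μ + dualPeriod δ τ m) = gram δ τ Φ s μ := by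
  have hadd : ∀ z, ((z, μ) : ℂ × ℂ) + prodPeriod δ τ (0, m) = (z, μ + dualPeriod δ τ m) :=
    fun z => by simp [prodPeriod, AddMonoidHom.prodMap_def]
  have hsm : ∀ i z, s i (z, μ + dualPeriod δ τ m) = P.mult (0, m) (z, μ) * s i (z, μ) := by
    intro i z
    have h := (hs i).2 (0, m) (z, μ) ⟨trivial, hμ⟩
    rw [hadd] at h
    rw [h]
    simp [ETilde, HolLineBundle.tensor, HolLineBundle.pullback, L0]
  -- The gauge multipliers are unitary, so the change of |Φ|² cancels the change of the sections.
  have hmet : ∀ z, ‖Φ (z, μ + dualPeriod δ τ m)‖ * ‖P.mult (0, m) (z, μ)‖ = ‖Φ (z, μ)‖ := by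
    intro z
    have h := hΦ.equivariant (0, m) (z, μ)
    rw [hadd] at h
    rw [← norm_mul, h, norm_mul, norm_gaugePullback_mult, one_mul]
  ext i j
  simp only [gram, Matrix.of_apply, hE]
  congr 1
  ext z
  simp only [hsm, hETilde, GaugeLineBundle.pullbackMetric, gaugePullback_metric, ← hmet z, map_mul]
  push_cast
  rw [mul_pow, ← Complex.mul_conj' (P.mult (0, m) (z, μ))]
  ring

/-- Both forms are multiples of the area form: ω is 1/τ₂ times it, and dw ∧ dw̄ is -2i times it. -/
theorem dwdwbar_eq_omega (u v : ℂ) :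
    -(Complex.I * δ / (2 * τ.im)) * dwdwbar u v = -(δ : ℂ) * (omega δ τ u v : ℂ) := by
  have hδ : (δ : ℝ) ≠ 0 := NeZero.ne _
  have hτ : τ.im ≠ 0 := τ.im_pos.ne'
  have h1 : omega δ τ u v = (u.re * v.im - v.re * u.im) / τ.im := by
    simp [omega, dx1, dx2]
    field_simp
    ring
  have h2 : dwdwbar u v = -2 * Complex.I * ((u.re * v.im - v.re * u.im : ℝ) : ℂ) := by
    apply Complex.ext <;> simp [dwdwbar] <;> ring
  have hτ' : (τ.im : ℂ) ≠ 0 := by exact_mod_cast hτ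
  rw [h1, h2, Complex.ofReal_div]
  field_simp
  rw [Complex.I_sq]
  ring

end Gram

end AdiabaticTorus

theorem theorem8 (δ : ℕ) [NeZero δ] (τ : UpperHalfPlane) :
    (∃ (P : AdiabaticTorus.HolLineBundle (AdiabaticTorus.prodPeriod δ τ)) (Φ : ℂ × ℂ → ℂ),
      AdiabaticTorus.IsPoincare P ∧
      AdiabaticTorus.GaugeLineBundle.IsIdentification P (AdiabaticTorus.gaugePullback δ τ) Φ) ∧
    ∀ P : AdiabaticTorus.HolLineBundle (AdiabaticTorus.prodPeriod δ τ),
      AdiabaticTorus.IsPoincare P →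
    ∀ Φ : ℂ × ℂ → ℂ,
      AdiabaticTorus.GaugeLineBundle.IsIdentification P (AdiabaticTorus.gaugePullback δ τ) Φ →
    AdiabaticTorus.IsHolVectorBundle P δ ∧
    ∀ U : Set (AdiabaticTorus.MHat δ τ), IsOpen U →
    ∀ s : Fin δ → ℂ × ℂ → ℂ, AdiabaticTorus.IsEFrame P U s →
      (∀ i j, ContDiffOn ℝ ∞ (fun μ => AdiabaticTorus.gram δ τ Φ s μ i j)
        (AdiabaticTorus.lift U)) ∧
      ∀ μ ∈ AdiabaticTorus.lift U,
        (AdiabaticTorus.gram δ τ Φ s μ).PosDef ∧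
        (∀ m : ℤ × ℤ, AdiabaticTorus.gram δ τ Φ s (μ + AdiabaticTorus.dualPeriod δ τ m) =
          AdiabaticTorus.gram δ τ Φ s μ) ∧
        ∀ u v : ℂ,
          AdiabaticTorus.chernCurvature (AdiabaticTorus.gram δ τ Φ s) μ u v =
            (-((Real.pi / τ.im : ℝ) : ℂ) * AdiabaticTorus.dwdwbar u v) •
              (1 : Matrix (Fin δ) (Fin δ) ℂ) ∧
          AdiabaticTorus.chernOne (AdiabaticTorus.gram δ τ Φ s) μ u v =
            -(Complex.I * δ / (2 * τ.im)) * AdiabaticTorus.dwdwbar u v ∧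
          AdiabaticTorus.chernOne (AdiabaticTorus.gram δ τ Φ s) μ u v =
            -(δ : ℂ) * (AdiabaticTorus.omega δ τ u v : ℂ) := by
  refine ⟨⟨_, _, AdiabaticTorus.isPoincare_std δ τ, AdiabaticTorus.isIdentification_std δ τ⟩,
    fun P _ Φ hΦ => ?_⟩
  obtain ⟨g, hgd, hg0, hΦg, hge⟩ := AdiabaticTorus.exists_comparison hΦ
  have hg : AdiabaticTorus.IsComparison P g := ⟨hgd, hg0, hge⟩
  refine ⟨⟨AdiabaticTorus.exists_frame hg, fun U hU s hs t ht => hs.exists_coeff hg hU ht⟩,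
    fun U hU s hs => ⟨AdiabaticTorus.contDiffOn_gram hg hΦg hU hs.isSection, fun μ hμ =>
      ⟨AdiabaticTorus.posDef_gram hg hΦg hs hμ,
        AdiabaticTorus.gram_add_dualPeriod hΦ hs.isSection hμ, fun u v => ?_⟩⟩⟩
  have h := AdiabaticTorus.chernCurvature_eq (AdiabaticTorus.isOpen_lift hU)
    (fun i j => (hs.isSection i).differentiableOn_thetaCoeff hg j)
    (fun y hy => hs.isUnit_thetaMatrix hg hy) (AdiabaticTorus.posDef_thetaGram δ τ).isUnit
    (fun y hy => AdiabaticTorus.gram_eq hg hΦg hs.isSection hy) hμ u v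
  rw [show 2 * Real.pi / τ.im / 2 = Real.pi / τ.im by ring] at h
  have h' := AdiabaticTorus.chernOne_eq h
  exact ⟨h, h', h'.trans (AdiabaticTorus.dwdwbar_eq_omega u v)⟩
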